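/- Let $n\ge r\ge 2$ and let $C\in\mathbb{R}^{n\times n}$ be row-stochastic (entrywise nonnegative with unit row sums), reducible, and with zero diagonal. Let $G(C)$ be its digraph, with an edge $i\to j$ iff $c_{ij}>0$, and assume that the globally reachable nodes of $G(C)$ (those to which every node has a directed path) are exactly $1,\dots,r$. Let $G(C_r)$ be the subgraph of $G(C)$ induced by $\{1,\dots,r\}$; it has star topology with center $k$ if all its edges are from or to $k$. Let $\Delta_n$ be the simplex $\{x\in\mathbb{R}^n: x\ge 0,\ \sum_i x_i=1\}$ with vertices $e_1,\dots,e_n$, put $x^2=(x_1^2,\dots,x_n^2)$, and consider the single-timescale DeGroot-Friedkin model $$x(t+1)=F(x(t)),\qquad F(x)=C^\top x+(I-C^\top)x^2,\qquad x(0)\in\Delta_n .$$ A sequence $x(t)$ converges exponentially to $x^*$ if there are $K$ and $\rho\in(0,1)$ (possibly depending on $x(0)$) such that $\|x(t)-x^*\|\le K\rho^t$ for all $t$. 1. If $r=2$, the set of equilibrium points of $F$ in $\Delta_n$ is $\{e_1,\dots,e_n\}\cup\{(\alpha,1-\alpha,0,\dots,0)^\top:\alpha\in[0,1]\}$, and for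 every $x(0)\in\Delta_n\setminus\{e_1,\dots,e_n\}$ there is an $\alpha\in[0,1]$ such that $x(t)$ converges exponentially to $(\alpha,1-\alpha,0,\dots,0)^\top$. 2. If $r\ge 3$ and $G(C_r)$ has star topology with center $k\in\{1,\dots,r\}$ (for instance $k=1$), the set of equilibrium points of $F$ in $\Delta_n$ is $\{e_1,\dots,e_n\}$, and $x(t)\to e_k$ as $t\to\infty$ for every $x(0)\in\Delta_n\setminus\{e_1,\dots,e_n\}$. 3. If $r\ge 3$ and $G(C_r)$ does not have star topology (with any center), there is an $x^*\in\Delta_n\setminus\{e_1,\dots,e_n\}$ such that the set of equilibrium points of $F$ in $\Delta_n$ is $\{e_1,\dots,e_n,x^*\}$; $x^*_i>0$ for $i\le r$ and $x^*_i=0$ for $i>r$; there is a unique $c\in\Delta_n$ with $c^\top C=c^\top$ (the vector of eigenvector centrality scores), and the entries of $x^*$ are ranked as those of $c$, that is, $x^*_i\le x^*_j$ if and only if $c_i\le c_j$ for all $i,j\in\{1,\dots,n\}$; and $x(t)$ converges exponentially to $x^*$ for every $x(0)\in\Delta_n\setminus\{e_1,\dots,e_n\}$. -/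

import Mathlib

open scoped Matrix

noncomputable section

namespace SocialPower

/-- The right-hand side `F(x) = Cᵀ x + (I - Cᵀ) x²` of the single-timescale DeGroot-Friedkin
model, where `x²` is the entrywise square of `x`. -/
def dfMap {n : ℕ} (C : Matrix (Fin n) (Fin n) ℝ) (x : Fin n → ℝ) : Fin n → ℝ :=
  Cᵀ *ᵥ x + (1 - Cᵀ) *ᵥ (x ^ 2)

/-- The self-weights `x(t)` of the model `x(t+1) = F(x(t))` started at `x(0) = x₀`. -/
def selfWeights {n : ℕ} (C : Matrix (Fin n) (Fin n) ℝ) (x₀ : Fin n → ℝ) (t : ℕ) : Fin n → ℝ :=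
  (dfMap C)^[t] x₀

/-- The vertices `e₁, …, eₙ` of the simplex (the autocratic configurations). -/
def vertices (n : ℕ) : Set (Fin n → ℝ) :=
  Set.range fun i : Fin n => Pi.single i (1 : ℝ)

/-- The equilibrium points of `F` on the simplex. -/
def equilibria {n : ℕ} (C : Matrix (Fin n) (Fin n) ℝ) : Set (Fin n → ℝ) :=
  {x | x ∈ stdSimplex ℝ (Fin n) ∧ dfMap C x = x}

/-- The digraph `G(C)` of a nonnegative matrix: there is an edge from `i` to `j` iff
`C i j > 0`. -/
def assocDigraph {n : ℕ} (C : Matrix (Fin n) (Fin n) ℝ) : Digraph (Fin n) :=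
  ⟨fun i j => 0 < C i j⟩

/-- A node is globally reachable if every node has a directed path to it. -/
def IsGloballyReachable {V : Type*} (G : Digraph V) (i : V) : Prop :=
  ∀ j : V, Relation.ReflTransGen G.Adj j i

/-- A digraph has star topology with center `k` if all its edges are from or to `k`. -/
def HasStarTopology {V : Type*} (G : Digraph V) (k : V) : Prop :=
  ∀ i j : V, G.Adj i j → i = k ∨ j = k

/-- The block `C_r` of `C` on the first `r` nodes; its digraph is the subgraph of `G(C)` induced
by these nodes. -/
def firstBlock {n r : ℕ} (h : r ≤ n) (C : Matrix (Fin n) (Fin n) ℝ) :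
    Matrix (Fin r) (Fin r) ℝ :=
  C.submatrix (Fin.castLE h) (Fin.castLE h)

/-- `c` is a dominant left eigenvector of `C`, normalized to the simplex:
`cᵀ C = cᵀ`. Its entries are the eigenvector centrality scores. -/
def IsDominantLeftEigenvector {n : ℕ} (C : Matrix (Fin n) (Fin n) ℝ) (c : Fin n → ℝ) : Prop :=
  c ∈ stdSimplex ℝ (Fin n) ∧ c ᵥ* C = c

/-- Exponential (geometric) convergence of the sequence `x` to the point `l`. -/
def ConvergesExponentially {n : ℕ} (x : ℕ → Fin n → ℝ) (l : Fin n → ℝ) : Prop :=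
  ∃ K ρ : ℝ, 0 < ρ ∧ ρ < 1 ∧ ∀ t : ℕ, ‖x t - l‖ ≤ K * ρ ^ t

/-- The vector `(α, 1 - α, 0, …, 0)`. -/
def firstTwo (n : ℕ) (α : ℝ) : Fin n → ℝ :=
  fun i => if i.val = 0 then α else if i.val = 1 then 1 - α else 0

end SocialPower

end

/-!
Write `flow u = u (1 - u)`. The model reads `F(x)ᵢ = xᵢ - flow xᵢ + ∑ⱼ flow xⱼ Cⱼᵢ`, so that `x`
is an equilibrium iff its flows form a left invariant vector of `C`, that is, iff `flow xⱼ = l cⱼ` for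
the centrality vector `c`, which is unique and supported on the globally reachable nodes
(`eq_smul_stationary`, `exists_flow_eq`). For at least three such nodes there is at most one
equilibrium besides the vertices (`eq_of_flow_eq`); in the star case there is none, as the center
has centrality `1 / 2` (`not_flow_eq_of_center`).

Global convergence. As long as all self-weights are at most `1 / 2`, flows are increasing functions
of self-weights, and a lower bound `l cⱼ ≤ flow xⱼ` for all `j` persists in time. It can be lost
only if some node `m` crosses `1 / 2`, and then the orbit enters the *dominance region* of `m`, where
`x m ≥ 1 / 2` and `m` has the least ratio of flow to centrality (`le_flow_dfMap_or_mem`). This region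
is invariant, and in it `x m` never decreases (`dfMap_mem_dominanceRegion`). So every orbit
eventually has a Lyapunov function: `x m` in a dominance region, and otherwise the least ratio of
flow to centrality over the globally reachable nodes. On the orbits of cluster points the Lyapunov
function is constant; since excess flow spreads along the edges, this forces the cluster points to
be equilibria (`flow_eq_of_dominant_const`, `flow_eq_of_least_ratio_const`). In the star case they
can only be the vertex of the center (`tendsto_center`). In the other case all centralities are
below `1 / 2`, which keeps orbits away from the vertices, so that a cluster point provides the
interior equilibrium, and its uniqueness gives convergence (`exists_tendsto`).

Exponential convergence follows from linear stability on the space of vectors of sum zero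
(`tendsto_jacobian_pow`). If the equilibrium has all entries at most `1 / 2`, its Jacobian is a
column-stochastic matrix with a positive row in some power, to which Doeblin's contraction argument
applies. If `x m > 1 / 2`, elimination of `x m` leaves a nonnegative matrix, which contracts a
weighted sup norm because it has no nonzero nonnegative subinvariant vector.

If only two nodes are globally reachable, they swap their flows. Their self-weights then change in a
step by at most twice the self-weight of the other nodes, which decays exponentially
(`exists_transientMass_le_geometric`).
-/

open scoped Matrix

namespace SocialPower
open Filter Topology

/-! ### Flows and influence networks -/

/-- The flow `u (1 - u)`: the amount of self-weight that a node of self-weight `u` hands over to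
its out-neighbours in one step of the model. -/
def flow (u : ℝ) : ℝ := u * (1 - u)

lemma flow_nonneg {u : ℝ} (h0 : 0 ≤ u) (h1 : u ≤ 1) : 0 ≤ flow u :=
  mul_nonneg h0 (by linarith)

lemma flow_pos {u : ℝ} (h0 : 0 < u) (h1 : u < 1) : 0 < flow u :=
  mul_pos h0 (by linarith)

lemma continuous_flow : Continuous flow := by unfold flow; fun_prop

lemma flow_le_flow {u v : ℝ} (h : u ≤ v) (h1 : u + v ≤ 1) : flow u ≤ flow v := by
  unfold flow; nlinarith

lemma flow_lt_flow {u v : ℝ} (h : u < v) (h1 : u + v < 1) : flow u < flow v := by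
  unfold flow; nlinarith

/-- If a node has flow at least `s` and receives at least `s`, then it has flow at least `s`
after one step too, unless it has crossed `1 / 2`. -/
lemma le_flow_of_step {s x z : ℝ} (hx : 0 ≤ x) (hs : 0 ≤ s) (h : s ≤ flow x)
    (hz : x - flow x + s ≤ z) (hz2 : z ≤ 1 / 2) : s ≤ flow z := by
  have h1 : flow (x - flow x + s) ≤ flow z := flow_le_flow hz (by linarith)
  refine le_trans ?_ h1
  unfold flow at *
  nlinarith [mul_nonneg (sub_nonneg.2 h) (by nlinarith : 0 ≤ x + (x ^ 2 + s))]

lemma lt_flow_of_step {s x z : ℝ} (hx : 0 ≤ x) (hs : 0 ≤ s) (h : s ≤ flow x)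
    (hz : x - flow x + s ≤ z) (hz2 : z ≤ 1 / 2) (hlt : s < flow x ∨ x - flow x + s < z) :
    s < flow z := by
  rcases hlt with hlt | hlt
  · have h1 : flow (x - flow x + s) ≤ flow z := flow_le_flow hz (by linarith)
    refine lt_of_lt_of_le ?_ h1
    have hx0 : 0 < x := by
      rcases hx.eq_or_lt with rfl | h0
      · simp [flow] at hlt; linarith
      · exact h0
    unfold flow at *
    nlinarith [mul_pos (sub_pos.2 hlt) (by nlinarith : 0 < x + (x ^ 2 + s))]
  · exact lt_of_le_of_lt (le_flow_of_step hx hs h le_rfl (by linarith))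
      (flow_lt_flow hlt (by linarith))

/-- A row-stochastic matrix with zero diagonal in whose digraph every node reaches each of the
first `r ≥ 2` nodes, while no edge leaves the set of these nodes. -/
structure IsInfluenceNetwork {n : ℕ} (r : ℕ) (C : Matrix (Fin n) (Fin n) ℝ) : Prop where
  nonneg : ∀ i j, 0 ≤ C i j
  row_sum : ∀ i, ∑ j, C i j = 1
  diag : ∀ i, C i i = 0
  closed : ∀ i j, i.val < r → 0 < C i j → j.val < r
  reach : ∀ i j : Fin n, j.val < r → Relation.ReflTransGen (fun a b => 0 < C a b) i j
  two_le : 2 ≤ r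
  le_card : r ≤ n

lemma IsInfluenceNetwork.of_globallyReachable {n r : ℕ} {C : Matrix (Fin n) (Fin n) ℝ}
    (hr : 2 ≤ r) (hrn : r ≤ n) (hC : C ∈ Matrix.rowStochastic ℝ (Fin n))
    (hdiag : ∀ i, C i i = 0)
    (hreach : ∀ i : Fin n, IsGloballyReachable (assocDigraph C) i ↔ i.val < r) :
    IsInfluenceNetwork r C where
  nonneg := hC.1
  row_sum i := by
    have := congrFun hC.2 i
    simpa [Matrix.mulVec, dotProduct] using this
  diag := hdiag
  closed i j hi hij := by
    rw [← hreach] at hi ⊢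
    exact fun l => (hi l).tail hij
  reach i j hj := (hreach j).2 hj i
  two_le := hr
  le_card := hrn

variable {n r : ℕ} {C : Matrix (Fin n) (Fin n) ℝ} {c x y x₀ z : Fin n → ℝ} {l l' : ℝ}

lemma dfMap_apply (C : Matrix (Fin n) (Fin n) ℝ) (x : Fin n → ℝ) (i : Fin n) :
    dfMap C x i = x i - flow (x i) + ∑ j, flow (x j) * C j i := by
  simp only [dfMap, Matrix.sub_mulVec, Matrix.one_mulVec, Pi.add_apply, Pi.sub_apply,
    Matrix.mulVec, dotProduct, Matrix.transpose_apply, Pi.pow_apply, flow]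
  have : ∑ j, x j * (1 - x j) * C j i = ∑ j, C j i * x j - ∑ j, C j i * x j ^ 2 := by
    rw [← Finset.sum_sub_distrib]
    exact Finset.sum_congr rfl fun j _ => by ring
  rw [this]; ring

lemma continuous_dfMap (C : Matrix (Fin n) (Fin n) ℝ) : Continuous (dfMap C) := by
  unfold dfMap; fun_prop

lemma continuous_dfMap_iterate (C : Matrix (Fin n) (Fin n) ℝ) (k : ℕ) :
    Continuous ((dfMap C)^[k]) := (continuous_dfMap C).iterate k

namespace IsInfluenceNetwork

variable (h : IsInfluenceNetwork r C)
include h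

lemma sum_vecMul (w : Fin n → ℝ) : ∑ i, ∑ j, w j * C j i = ∑ j, w j := by
  rw [Finset.sum_comm]
  refine Finset.sum_congr rfl fun j _ => ?_
  rw [← Finset.mul_sum, h.row_sum, mul_one]

lemma le_one (i j : Fin n) : C i j ≤ 1 := by
  rw [← h.row_sum i]
  exact Finset.single_le_sum (fun j _ => h.nonneg i j) (Finset.mem_univ j)

lemma exists_edge (i : Fin n) : ∃ j, j ≠ i ∧ 0 < C i j := by
  by_contra! hcon
  have : ∑ j, C i j = 0 := Finset.sum_eq_zero fun j _ => by
    by_cases hj : j = i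
    · rw [hj, h.diag]
    · exact le_antisymm (hcon j hj) (h.nonneg i j)
  rw [h.row_sum] at this
  exact one_ne_zero this

lemma exists_ne (j : Fin n) : ∃ i : Fin n, i.val < r ∧ i ≠ j := by
  have := h.two_le
  have := h.le_card
  by_cases hj : j.val = 0
  · exact ⟨⟨1, by omega⟩, by simp; omega, fun hh => by rw [← hh] at hj; simp at hj⟩
  · exact ⟨⟨0, by omega⟩, by simp; omega, fun hh => hj (by rw [← hh])⟩

lemma eq_zero_of_lt {i j : Fin n} (hi : i.val < r) (hj : r ≤ j.val) : C i j = 0 := by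
  by_contra hne
  have := h.closed i j hi (lt_of_le_of_ne (h.nonneg i j) (Ne.symm hne))
  omega

/-! ### Invariant vectors -/

/-- A subinvariant vector is invariant: multiplication by a stochastic matrix
preserves the total mass. -/
lemma invariant_of_subinvariant {w : Fin n → ℝ} (hle : ∀ i, w i ≤ ∑ j, w j * C j i) (i : Fin n) :
    ∑ j, w j * C j i = w i := by
  have := (Finset.sum_eq_sum_iff_of_le (fun i _ => hle i)).1 (h.sum_vecMul w).symm
  exact (this i (Finset.mem_univ i)).symm

lemma pos_of_reach {w : Fin n → ℝ} (hw : ∀ i, 0 ≤ w i)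
    (hinv : ∀ i, ∑ j, w j * C j i = w i) {a b : Fin n}
    (hab : Relation.ReflTransGen (fun a b => 0 < C a b) a b) (ha : 0 < w a) : 0 < w b := by
  induction hab with
  | refl => exact ha
  | @tail b c _ hbc ih =>
    rw [← hinv c]
    exact lt_of_lt_of_le (mul_pos ih hbc) (Finset.single_le_sum
      (f := fun j => w j * C j c) (fun j _ => mul_nonneg (hw j) (h.nonneg j c))
      (Finset.mem_univ b))

/-- Every mass of a subinvariant vector would reach each of the first `r` nodes. -/
lemma eq_zero_of_subinvariant {w : Fin n → ℝ} (hw : ∀ i, 0 ≤ w i)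
    (hle : ∀ i, w i ≤ ∑ j, w j * C j i) {i : Fin n} (hi : i.val < r) (hwi : w i = 0)
    (j : Fin n) : w j = 0 := by
  by_contra hne
  exact (h.pos_of_reach hw (h.invariant_of_subinvariant hle) (h.reach j i hi)
    (lt_of_le_of_ne (hw j) (Ne.symm hne))).ne' hwi

/-- Maximum principle: the positive part of `f` is subinvariant if `f` is so where it is
positive. -/
lemma nonpos_of_subinvariant {f : Fin n → ℝ} {m : Fin n} (hm : m.val < r) (hfm : f m ≤ 0)
    (hle : ∀ i, i ≠ m → f i ≤ ∑ j, f j * C j i) (i : Fin n) : f i ≤ 0 := by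
  have hsum : ∀ i, 0 ≤ ∑ j, max (f j) 0 * C j i := fun i =>
    Finset.sum_nonneg fun j _ => mul_nonneg (le_max_right _ _) (h.nonneg j i)
  have h0 := h.eq_zero_of_subinvariant (w := fun j => max (f j) 0) (fun j => le_max_right _ _)
    (fun i => by
      by_cases him : i = m
      · subst him
        simpa [max_eq_right hfm] using hsum i
      · refine max_le ((hle i him).trans (Finset.sum_le_sum fun j _ =>
          mul_le_mul_of_nonneg_right (le_max_left _ _) (h.nonneg j i))) (hsum i))
    hm (max_eq_right hfm) i
  exact max_eq_right_iff.1 h0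

/-- A square matrix with right eigenvalue `1` has left eigenvalue `1`; the absolute values of a
left eigenvector are subinvariant, hence invariant. -/
lemma exists_dominantLeftEigenvector : ∃ c, IsDominantLeftEigenvector C c := by
  have hpos : 0 < n := by have := h.two_le; have := h.le_card; omega
  have hdet : (C - 1).det = 0 := by
    rw [← Matrix.exists_mulVec_eq_zero_iff]
    refine ⟨1, ?_, ?_⟩
    · intro h0
      simpa using congrFun h0 ⟨0, hpos⟩
    · ext i
      rw [Matrix.sub_mulVec, Matrix.one_mulVec]
      simp [Matrix.mulVec, dotProduct, h.row_sum]
  obtain ⟨w, hw0, hw⟩ := Matrix.exists_vecMul_eq_zero_iff.2 hdet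
  rw [Matrix.vecMul_sub, Matrix.vecMul_one, sub_eq_zero] at hw
  have habs : ∀ i, ∑ j, |w j| * C j i = |w i| := by
    refine h.invariant_of_subinvariant (w := fun j => |w j|) fun i => ?_
    rw [show w i = ∑ j, w j * C j i from (congrFun hw i).symm]
    refine (Finset.abs_sum_le_sum_abs _ _).trans (Finset.sum_le_sum fun j _ => ?_)
    rw [abs_mul, abs_of_nonneg (h.nonneg j i)]
  set s := ∑ j, |w j| with hs
  have hspos : 0 < s := by
    obtain ⟨j, hj⟩ := Function.ne_iff.1 hw0
    exact lt_of_lt_of_le (abs_pos.2 hj) (Finset.single_le_sum (f := fun j => |w j|)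
      (fun j _ => abs_nonneg _) (Finset.mem_univ j))
  refine ⟨fun j => |w j| / s, ⟨fun j => by positivity, ?_⟩, ?_⟩
  · rw [← Finset.sum_div, div_self hspos.ne']
  · ext i
    simp only [Matrix.vecMul, dotProduct]
    rw [← habs i, Finset.sum_div]
    exact Finset.sum_congr rfl fun j _ => by ring

omit h in
lemma stationary_apply (hc : IsDominantLeftEigenvector C c) (i : Fin n) :
    ∑ j, c j * C j i = c i := congrFun hc.2 i

omit h in
lemma stationary_nonneg (hc : IsDominantLeftEigenvector C c) (i : Fin n) : 0 ≤ c i := hc.1.1 i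

lemma stationary_pos (hc : IsDominantLeftEigenvector C c) {i : Fin n} (hi : i.val < r) :
    0 < c i := by
  refine lt_of_le_of_ne (hc.1.1 i) fun h0 => ?_
  have := h.eq_zero_of_subinvariant hc.1.1 (fun i => (stationary_apply hc i).ge) hi h0.symm
  have h1 := hc.1.2
  rw [Finset.sum_eq_zero fun j _ => this j] at h1
  exact zero_ne_one h1

lemma stationary_eq_zero (hc : IsDominantLeftEigenvector C c) {i : Fin n} (hi : r ≤ i.val) :
    c i = 0 := by
  have hrn := h.le_card
  have hr := h.two_le
  have := h.eq_zero_of_subinvariant (w := fun j => if j.val < r then 0 else c j)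
    (fun j => by split_ifs; exacts [le_rfl, hc.1.1 j]) (fun j => ?_)
    (i := ⟨0, by omega⟩) (by simp; omega) (by simp; omega) i
  · simpa [Nat.not_lt.2 hi] using this
  · split_ifs with hj
    · refine Finset.sum_nonneg fun l _ => mul_nonneg ?_ (h.nonneg l j)
      split_ifs; exacts [le_rfl, hc.1.1 l]
    · rw [← stationary_apply hc j]
      refine Finset.sum_le_sum fun l _ => ?_
      split_ifs with hl
      · rw [h.eq_zero_of_lt hl (not_lt.1 hj)]; simp
      · exact le_rfl

/-- The invariant vectors form a line. -/
lemma eq_smul_stationary (hc : IsDominantLeftEigenvector C c) {w : Fin n → ℝ}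
    (hw : ∀ i, ∑ j, w j * C j i = w i) (i : Fin n) : w i = (∑ j, w j) * c i := by
  have hrn := h.le_card
  have hr := h.two_le
  have hc0 := h.stationary_pos hc (i := ⟨0, by omega⟩) (by simp; omega)
  set m : Fin n := ⟨0, by omega⟩
  have hm : m.val < r := by simp [m]; omega
  have key : ∀ i, w i = w m / c m * c i := by
    intro i
    have hfm : w m - w m / c m * c m = 0 := by field_simp; ring
    have e : ∀ i, ∑ j, (w j - w m / c m * c j) * C j i = w i - w m / c m * c i := fun i => by
      rw [← stationary_apply hc i, ← hw i, Finset.mul_sum, ← Finset.sum_sub_distrib]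
      exact Finset.sum_congr rfl fun j _ => by ring
    have h1 := h.nonpos_of_subinvariant (f := fun j => w j - w m / c m * c j) hm hfm.le
      (fun i _ => (e i).ge) i
    have h2 := h.nonpos_of_subinvariant (f := fun j => -(w j - w m / c m * c j)) hm
      (by simp only [hfm]; simp) (fun i _ => by simp only [neg_mul, Finset.sum_neg_distrib, e]; rfl) i
    linarith
  have hs : ∑ j, w j = w m / c m := by
    rw [Finset.sum_congr rfl fun j _ => key j, ← Finset.mul_sum, hc.1.2, mul_one]
  rw [hs]; exact key i

lemma dominantLeftEigenvector_unique (hc : IsDominantLeftEigenvector C c) {c' : Fin n → ℝ}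
    (hc' : IsDominantLeftEigenvector C c') : c' = c := by
  ext i
  rw [h.eq_smul_stationary hc (stationary_apply hc') i, hc'.1.2, one_mul]

end IsInfluenceNetwork

/-! ### The dynamics on the simplex -/

/-- The points of the simplex that are not vertices: no node holds all self-weight. -/
def nonAutocratic (n : ℕ) : Set (Fin n → ℝ) :=
  {x | x ∈ stdSimplex ℝ (Fin n) ∧ ∀ j, x j < 1}

lemma add_le_one_of_mem_stdSimplex (hx : x ∈ stdSimplex ℝ (Fin n)) {i j : Fin n} (hij : i ≠ j) :
    x i + x j ≤ 1 := by
  rw [← hx.2, ← Finset.sum_pair hij]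
  exact Finset.sum_le_sum_of_subset_of_nonneg (Finset.subset_univ _) fun l _ _ => hx.1 l

lemma le_one_of_mem_stdSimplex (hx : x ∈ stdSimplex ℝ (Fin n)) (i : Fin n) : x i ≤ 1 := by
  rw [← hx.2]
  exact Finset.single_le_sum (fun j _ => hx.1 j) (Finset.mem_univ i)

lemma flow_nonneg_of_mem_stdSimplex (hx : x ∈ stdSimplex ℝ (Fin n)) (i : Fin n) :
    0 ≤ flow (x i) := flow_nonneg (hx.1 i) (le_one_of_mem_stdSimplex hx i)

lemma exists_pos_of_mem_stdSimplex (hx : x ∈ stdSimplex ℝ (Fin n)) : ∃ j, 0 < x j := by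
  by_contra! hcon
  have := hx.2
  rw [Finset.sum_eq_zero fun j _ => le_antisymm (hcon j) (hx.1 j)] at this
  exact zero_ne_one this

lemma eq_single_of_mem_stdSimplex (hx : x ∈ stdSimplex ℝ (Fin n)) {i : Fin n} (hi : 1 ≤ x i) :
    x = Pi.single i 1 := by
  ext j
  by_cases hj : j = i
  · subst hj
    simpa using le_antisymm (le_one_of_mem_stdSimplex hx j) hi
  · have := add_le_one_of_mem_stdSimplex hx hj
    have := hx.1 j
    simp only [Pi.single_eq_of_ne hj]
    linarith

lemma nonAutocratic_eq (n : ℕ) : nonAutocratic n = stdSimplex ℝ (Fin n) \ vertices n := by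
  ext x
  refine ⟨fun hx => ⟨hx.1, ?_⟩, fun hx => ⟨hx.1, fun j => ?_⟩⟩
  · rintro ⟨i, rfl⟩
    simpa using hx.2 i
  · by_contra! hj
    exact hx.2 ⟨j, (eq_single_of_mem_stdSimplex hx.1 hj).symm⟩

namespace IsInfluenceNetwork

variable (h : IsInfluenceNetwork r C)
include h

lemma sq_le_dfMap (hx : x ∈ stdSimplex ℝ (Fin n)) (i : Fin n) : x i ^ 2 ≤ dfMap C x i := by
  rw [dfMap_apply]
  have : 0 ≤ ∑ j, flow (x j) * C j i := Finset.sum_nonneg fun j _ =>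
    mul_nonneg (flow_nonneg_of_mem_stdSimplex hx j) (h.nonneg j i)
  unfold flow at *
  nlinarith

lemma sum_dfMap (x : Fin n → ℝ) : ∑ i, dfMap C x i = ∑ i, x i := by
  simp only [dfMap_apply, Finset.sum_add_distrib, Finset.sum_sub_distrib,
    h.sum_vecMul fun j => flow (x j)]
  ring

lemma dfMap_mem (hx : x ∈ stdSimplex ℝ (Fin n)) : dfMap C x ∈ stdSimplex ℝ (Fin n) :=
  ⟨fun i => (sq_nonneg _).trans (h.sq_le_dfMap hx i), by rw [h.sum_dfMap, hx.2]⟩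

lemma iterate_mem (hx : x ∈ stdSimplex ℝ (Fin n)) (k : ℕ) :
    (dfMap C)^[k] x ∈ stdSimplex ℝ (Fin n) := by
  induction k with
  | zero => exact hx
  | succ k ih => rw [Function.iterate_succ_apply']; exact h.dfMap_mem ih

/-- Since `F(x)ᵢ ≥ xᵢ²`, the support never shrinks, so that only a vertex is mapped to a
vertex. -/
lemma dfMap_mem_nonAutocratic (hx : x ∈ nonAutocratic n) : dfMap C x ∈ nonAutocratic n := by
  refine ⟨h.dfMap_mem hx.1, fun j => ?_⟩
  by_contra! hj
  have hF := eq_single_of_mem_stdSimplex (h.dfMap_mem hx.1) hj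
  have h0 : ∀ i, i ≠ j → x i = 0 := fun i hi => by
    have := h.sq_le_dfMap hx.1 i
    rw [hF, Pi.single_eq_of_ne hi] at this
    exact pow_eq_zero_iff two_ne_zero |>.1 (le_antisymm this (sq_nonneg _))
  have := hx.1.2
  rw [Finset.sum_eq_single j (fun i _ hi => h0 i hi) (by simp)] at this
  exact (hx.2 j).ne this

lemma iterate_mem_nonAutocratic (hx : x ∈ nonAutocratic n) (k : ℕ) :
    (dfMap C)^[k] x ∈ nonAutocratic n := by
  induction k with
  | zero => exact hx
  | succ k ih => rw [Function.iterate_succ_apply']; exact h.dfMap_mem_nonAutocratic ih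

/-- A property of nodes that persists in time and spreads along edges is eventually shared by
the globally reachable nodes. -/
lemma eventually_of_spreads {Q : (Fin n → ℝ) → Prop} {P : (Fin n → ℝ) → Fin n → Prop}
    (hQ : ∀ x, Q x → Q (dfMap C x)) (hself : ∀ x j, Q x → P x j → P (dfMap C x) j)
    (hedge : ∀ x j i, Q x → P x j → 0 < C j i → P (dfMap C x) i) (hx : Q x) {j : Fin n}
    (hj : P x j) : ∀ᶠ k in atTop, ∀ i : Fin n, i.val < r → P ((dfMap C)^[k] x) i := by
  have hQk : ∀ k, Q ((dfMap C)^[k] x) := fun k => by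
    induction k with
    | zero => exact hx
    | succ k ih => rw [Function.iterate_succ_apply']; exact hQ _ ih
  have hpath : ∀ i, Relation.ReflTransGen (fun a b => 0 < C a b) j i →
      ∀ᶠ k in atTop, P ((dfMap C)^[k] x) i := fun i hji => by
    induction hji with
    | refl =>
      refine Eventually.of_forall fun k => ?_
      induction k with
      | zero => exact hj
      | succ k ih => rw [Function.iterate_succ_apply']; exact hself _ _ (hQk k) ih
    | @tail a b _ hab ih =>
      obtain ⟨K, hK⟩ := eventually_atTop.1 ih
      refine eventually_atTop.2 ⟨K + 1, fun k hk => ?_⟩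
      obtain ⟨k, rfl⟩ := Nat.exists_eq_add_of_le' (Nat.one_le_of_lt hk)
      rw [Function.iterate_succ_apply']
      exact hedge _ _ _ (hQk k) (hK k (by omega)) hab
  rw [eventually_all]
  intro i
  by_cases hi : i.val < r
  · filter_upwards [hpath i (h.reach j i hi)] with k hk _ using hk
  · exact Eventually.of_forall fun k hi' => absurd hi' hi

/-- The support of a non-vertex spreads along edges. -/
lemma eventually_pos (hx : x ∈ nonAutocratic n) :
    ∀ᶠ k in atTop, ∀ i : Fin n, i.val < r → 0 < (dfMap C)^[k] x i := by
  obtain ⟨j, hj⟩ := exists_pos_of_mem_stdSimplex hx.1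
  refine h.eventually_of_spreads (Q := (· ∈ nonAutocratic n)) (P := fun x i => 0 < x i)
    (fun x hx => h.dfMap_mem_nonAutocratic hx)
    (fun x j hx hj => (pow_pos hj 2).trans_le (h.sq_le_dfMap hx.1 j))
    (fun x j i hx hj hji => ?_) hx hj
  rw [dfMap_apply]
  have h1 : flow (x j) * C j i ≤ ∑ l, flow (x l) * C l i :=
    Finset.single_le_sum (f := fun l => flow (x l) * C l i)
      (fun l _ => mul_nonneg (flow_nonneg_of_mem_stdSimplex hx.1 l) (h.nonneg l i))
      (Finset.mem_univ j)
  have h2 := mul_pos (flow_pos hj (hx.2 j)) hji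
  have h3 : 0 ≤ x i - flow (x i) := by unfold flow; nlinarith [sq_nonneg (x i)]
  linarith

end IsInfluenceNetwork

/-! ### Dominance regions and cluster points -/

/-- The points of the simplex at which node `m` holds at least half of the self-weight and
minimizes the ratio of flow to centrality `c`. -/
def dominanceRegion {n : ℕ} (c : Fin n → ℝ) (m : Fin n) : Set (Fin n → ℝ) :=
  {x | x ∈ stdSimplex ℝ (Fin n) ∧ 1 / 2 ≤ x m ∧ ∀ j, flow (x m) * c j ≤ flow (x j) * c m}

lemma isClosed_dominanceRegion (c : Fin n → ℝ) (m : Fin n) :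
    IsClosed (dominanceRegion c m) := by
  have hf := continuous_flow
  have heq : dominanceRegion c m = stdSimplex ℝ (Fin n) ∩ ({x | 1 / 2 ≤ x m} ∩
      ⋂ j, {x | flow (x m) * c j ≤ flow (x j) * c m}) := by
    ext x
    simp only [dominanceRegion, Set.mem_ofPred_eq, Set.mem_inter_iff, Set.mem_iInter]
  rw [heq]
  exact (isClosed_stdSimplex ℝ (Fin n)).inter ((isClosed_le continuous_const
    (continuous_apply m)).inter (isClosed_iInter fun j => isClosed_le (by fun_prop) (by fun_prop)))

lemma mem_dominanceRegion_of_le {m : Fin n} {l : ℝ} (hz : z ∈ stdSimplex ℝ (Fin n))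
    (hc : ∀ j, 0 ≤ c j) (hm : 1 / 2 ≤ z m) (hlm : flow (z m) ≤ l * c m)
    (hl : ∀ j, j ≠ m → z j ≤ 1 / 2 → l * c j ≤ flow (z j)) : z ∈ dominanceRegion c m := by
  refine ⟨hz, hm, fun j => ?_⟩
  by_cases hj : j = m
  · rw [hj]
  have h1 := add_le_one_of_mem_stdSimplex hz hj
  have h2 := hl j hj (by linarith)
  calc flow (z m) * c j ≤ l * c m * c j := mul_le_mul_of_nonneg_right hlm (hc j)
    _ = l * c j * c m := by ring
    _ ≤ _ := mul_le_mul_of_nonneg_right h2 (hc m)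

/-- Along the cluster points of an orbit, and along their own orbits, a continuous function that
converges along the orbit is constant. -/
lemma apply_iterate_of_mapClusterPt {V : (Fin n → ℝ) → ℝ} {v : ℝ} (hV : Continuous V)
    (hv : Tendsto (fun t => V ((dfMap C)^[t] x₀)) atTop (𝓝 v))
    (hz : MapClusterPt z atTop fun t => (dfMap C)^[t] x₀) (k : ℕ) :
    V ((dfMap C)^[k] z) = v := by
  have h1 : MapClusterPt (V ((dfMap C)^[k] z)) atTop
      ((fun y => V ((dfMap C)^[k] y)) ∘ fun t => (dfMap C)^[t] x₀) :=
    MapClusterPt.continuousAt_comp (f := fun y => V ((dfMap C)^[k] y))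
      (hV.comp (continuous_dfMap_iterate C k)).continuousAt hz
  have h2 : Tendsto ((fun y => V ((dfMap C)^[k] y)) ∘ fun t => (dfMap C)^[t] x₀) atTop (𝓝 v) := by
    refine ((tendsto_add_atTop_iff_nat k).2 hv).congr fun t => ?_
    simp only [Function.comp_apply]
    rw [add_comm, Function.iterate_add_apply]
  have h3 : ClusterPt (V ((dfMap C)^[k] z)) (𝓝 v) := ClusterPt.mono h1 h2
  exact eq_of_nhds_neBot h3

namespace IsInfluenceNetwork

variable (h : IsInfluenceNetwork r C)
include h

lemma le_sum_flow (hc : IsDominantLeftEigenvector C c) {l : ℝ}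
    (hl : ∀ j, l * c j ≤ flow (x j)) (i : Fin n) : l * c i ≤ ∑ j, flow (x j) * C j i := by
  rw [← stationary_apply hc i, Finset.mul_sum]
  refine Finset.sum_le_sum fun j _ => ?_
  rw [← mul_assoc]
  exact mul_le_mul_of_nonneg_right (hl j) (h.nonneg j i)

lemma lt_sum_flow (hc : IsDominantLeftEigenvector C c) {l : ℝ}
    (hl : ∀ j, l * c j ≤ flow (x j)) {a i : Fin n} (ha : l * c a < flow (x a)) (hai : 0 < C a i) :
    l * c i < ∑ j, flow (x j) * C j i := by
  rw [← stationary_apply hc i, Finset.mul_sum]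
  refine Finset.sum_lt_sum (fun j _ => ?_) ⟨a, Finset.mem_univ a, ?_⟩
  · rw [← mul_assoc]
    exact mul_le_mul_of_nonneg_right (hl j) (h.nonneg j i)
  · rw [← mul_assoc]
    exact mul_lt_mul_of_pos_right ha hai

lemma le_flow_dfMap (hc : IsDominantLeftEigenvector C c) (hx : x ∈ stdSimplex ℝ (Fin n)) {l : ℝ}
    (hl0 : 0 ≤ l) (hl : ∀ j, l * c j ≤ flow (x j)) (i : Fin n) (hi : dfMap C x i ≤ 1 / 2) :
    l * c i ≤ flow (dfMap C x i) := by
  refine le_flow_of_step (hx.1 i) (mul_nonneg hl0 (stationary_nonneg hc i)) (hl i) ?_ hi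
  rw [dfMap_apply]
  linarith [h.le_sum_flow hc hl i]

lemma lt_flow_dfMap (hc : IsDominantLeftEigenvector C c) (hx : x ∈ stdSimplex ℝ (Fin n)) {l : ℝ}
    (hl0 : 0 ≤ l) (hl : ∀ j, l * c j ≤ flow (x j)) (i : Fin n) (hi : dfMap C x i ≤ 1 / 2)
    (hlt : l * c i < flow (x i) ∨ ∃ a, l * c a < flow (x a) ∧ 0 < C a i) :
    l * c i < flow (dfMap C x i) := by
  refine lt_flow_of_step (hx.1 i) (mul_nonneg hl0 (stationary_nonneg hc i)) (hl i) ?_ hi ?_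
  · rw [dfMap_apply]
    linarith [h.le_sum_flow hc hl i]
  · rcases hlt with hlt | ⟨a, ha, hai⟩
    · exact Or.inl hlt
    · right
      rw [dfMap_apply]
      linarith [h.lt_sum_flow hc hl ha hai]

/-- A lower bound on the ratios of flow to centrality persists, unless the orbit enters a
dominance region: the only way for a flow to fall is that its node crosses `1 / 2`. -/
lemma le_flow_dfMap_or_mem (hc : IsDominantLeftEigenvector C c) (hx : x ∈ stdSimplex ℝ (Fin n))
    {l : ℝ} (hl0 : 0 ≤ l) (hl : ∀ j, l * c j ≤ flow (x j)) :
    (∀ j, l * c j ≤ flow (dfMap C x j)) ∨ ∃ m, m.val < r ∧ dfMap C x ∈ dominanceRegion c m := by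
  by_contra! hcon
  obtain ⟨⟨m, hm⟩, hcon⟩ := hcon
  have hF := h.dfMap_mem hx
  have hcm : m.val < r := by
    by_contra hmr
    rw [h.stationary_eq_zero hc (not_lt.1 hmr), mul_zero] at hm
    exact hm.not_ge (flow_nonneg_of_mem_stdSimplex hF m)
  have hm2 : 1 / 2 ≤ dfMap C x m := by
    by_contra! hlt
    exact hm.not_ge (h.le_flow_dfMap hc hx hl0 hl m hlt.le)
  exact hcon m hcm (mem_dominanceRegion_of_le hF hc.1.1 hm2 hm.le
    fun j _ hj => h.le_flow_dfMap hc hx hl0 hl j hj)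

omit h in
lemma le_flow_of_mem_dominanceRegion {m : Fin n} (hcm : 0 < c m) (hx : x ∈ dominanceRegion c m)
    (j : Fin n) : flow (x m) / c m * c j ≤ flow (x j) := by
  rw [div_mul_eq_mul_div, div_le_iff₀ hcm]
  exact hx.2.2 j

/-- A dominance region is invariant, and the self-weight of its dominant node never decreases. -/
lemma dfMap_mem_dominanceRegion (hc : IsDominantLeftEigenvector C c) {m : Fin n} (hm : m.val < r)
    (hx : x ∈ dominanceRegion c m) :
    dfMap C x ∈ dominanceRegion c m ∧ x m ≤ dfMap C x m := by
  have hcm := h.stationary_pos hc hm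
  have hl := le_flow_of_mem_dominanceRegion hcm hx
  have hl0 : 0 ≤ flow (x m) / c m := div_nonneg (flow_nonneg_of_mem_stdSimplex hx.1 m) hcm.le
  have hle : x m ≤ dfMap C x m := by
    have := h.le_sum_flow hc hl m
    rw [div_mul_cancel₀ _ hcm.ne'] at this
    rw [dfMap_apply]
    linarith
  refine ⟨mem_dominanceRegion_of_le (l := flow (x m) / c m) (h.dfMap_mem hx.1) hc.1.1
    (hx.2.1.trans hle) ?_ fun j _ hj => h.le_flow_dfMap hc hx.1 hl0 hl j hj, hle⟩
  rw [div_mul_cancel₀ _ hcm.ne']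
  have := hx.2.1
  unfold flow
  nlinarith

lemma iterate_mem_dominanceRegion (hc : IsDominantLeftEigenvector C c) {m : Fin n}
    (hm : m.val < r) (hx : x ∈ dominanceRegion c m) (k : ℕ) :
    (dfMap C)^[k] x ∈ dominanceRegion c m := by
  induction k with
  | zero => exact hx
  | succ k ih =>
    rw [Function.iterate_succ_apply']
    exact (h.dfMap_mem_dominanceRegion hc hm ih).1

lemma monotone_iterate_dominant (hc : IsDominantLeftEigenvector C c) {m : Fin n}
    (hm : m.val < r) (hx : x ∈ dominanceRegion c m) :
    Monotone fun k => (dfMap C)^[k] x m := by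
  refine monotone_nat_of_le_succ fun k => ?_
  rw [Function.iterate_succ_apply']
  exact (h.dfMap_mem_dominanceRegion hc hm (h.iterate_mem_dominanceRegion hc hm hx k)).2

/-- An orbit in a dominance region along which the dominant self-weight is constant is an
equilibrium: any excess flow would spread until it reaches the dominant node. -/
lemma flow_eq_of_dominant_const (hc : IsDominantLeftEigenvector C c) {m : Fin n} (hm : m.val < r)
    (hx : x ∈ dominanceRegion c m) (hconst : ∀ k, (dfMap C)^[k] x m = x m) (j : Fin n) :
    flow (x j) = flow (x m) / c m * c j := by
  have hcm := h.stationary_pos hc hm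
  refine le_antisymm (not_lt.1 fun hlt => ?_) (le_flow_of_mem_dominanceRegion hcm hx j)
  have hpath := h.reach j m hm
  induction hpath using Relation.ReflTransGen.head_induction_on generalizing x with
  | refl => rw [div_mul_cancel₀ _ hcm.ne'] at hlt; exact hlt.false
  | @head a b hab _ ih =>
    have hl := le_flow_of_mem_dominanceRegion hcm hx
    have hl0 : 0 ≤ flow (x m) / c m := div_nonneg (flow_nonneg_of_mem_stdSimplex hx.1 m) hcm.le
    have hF := h.dfMap_mem_dominanceRegion hc hm hx
    have hFm : dfMap C x m = x m := hconst 1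
    by_cases hbm : b = m
    · subst hbm
      have := h.lt_sum_flow hc hl hlt hab
      rw [div_mul_cancel₀ _ hcm.ne'] at this
      rw [dfMap_apply] at hFm
      linarith
    · refine ih hF.1 (fun k => ?_) ?_
      · rw [← Function.iterate_succ_apply, hconst, hFm]
      · have := add_le_one_of_mem_stdSimplex hF.1.1 hbm
        have := hF.1.2.1
        rw [hFm]
        exact h.lt_flow_dfMap hc hx.1 hl0 hl b (by linarith) (Or.inr ⟨a, hlt, hab⟩)

/-- The cluster points of an orbit that enters a dominance region are equilibria. -/
lemma clusterPt_of_mem_dominanceRegion (hc : IsDominantLeftEigenvector C c) {m : Fin n}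
    (hm : m.val < r) {T : ℕ} (hT : (dfMap C)^[T] x₀ ∈ dominanceRegion c m)
    (hz : MapClusterPt z atTop fun t => (dfMap C)^[t] x₀) :
    z ∈ dominanceRegion c m ∧ ∀ j, flow (z j) = flow (z m) / c m * c j := by
  have hmem : ∀ t, T ≤ t → (dfMap C)^[t] x₀ ∈ dominanceRegion c m := fun t ht => by
    obtain ⟨k, rfl⟩ := Nat.exists_eq_add_of_le' ht
    rw [Function.iterate_add_apply]
    exact h.iterate_mem_dominanceRegion hc hm hT k
  have hzm : z ∈ dominanceRegion c m :=
    (isClosed_dominanceRegion c m).mem_of_mapClusterPt hz (eventually_atTop.2 ⟨T, hmem⟩)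
  refine ⟨hzm, h.flow_eq_of_dominant_const hc hm hzm ?_⟩
  have hbdd : BddAbove (Set.range fun k => (dfMap C)^[k] ((dfMap C)^[T] x₀) m) := by
    refine ⟨1, ?_⟩
    rintro _ ⟨k, rfl⟩
    exact le_one_of_mem_stdSimplex (h.iterate_mem_dominanceRegion hc hm hT k).1 m
  have hlim := tendsto_atTop_ciSup (h.monotone_iterate_dominant hc hm hT) hbdd
  have hlim' : Tendsto (fun t => (dfMap C)^[t] x₀ m) atTop
      (𝓝 (⨆ k, (dfMap C)^[k] ((dfMap C)^[T] x₀) m)) := by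
    rw [← tendsto_add_atTop_iff_nat T]
    simpa only [Function.iterate_add_apply] using hlim
  have key := apply_iterate_of_mapClusterPt (continuous_apply m) hlim' hz
  intro k
  rw [key k, ← key 0]
  rfl

/-- An orbit along which the least ratio of flow to centrality is constant is an equilibrium:
otherwise excess flow would spread to all globally reachable nodes, and raise the least ratio. -/
lemma flow_eq_of_least_ratio_const (hc : IsDominantLeftEigenvector C c) {l : ℝ} (hl0 : 0 < l)
    (hx : x ∈ stdSimplex ℝ (Fin n))
    (hle : ∀ k j, l * c j ≤ flow ((dfMap C)^[k] x j))
    (heq : ∀ k, ∃ j : Fin n, j.val < r ∧ flow ((dfMap C)^[k] x j) = l * c j) (j : Fin n) :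
    flow (x j) = l * c j := by
  by_contra hne
  let Q : (Fin n → ℝ) → Prop := fun x => x ∈ stdSimplex ℝ (Fin n) ∧
    (∀ k j, l * c j ≤ flow ((dfMap C)^[k] x j)) ∧
    (∀ k, ∃ j : Fin n, j.val < r ∧ flow ((dfMap C)^[k] x j) = l * c j) ∧
    ∃ j, flow (x j) ≠ l * c j
  let P : (Fin n → ℝ) → Fin n → Prop := fun x j => x j ≤ 1 / 2 → l * c j < flow (x j)
  have hrn := h.le_card
  have hr := h.two_le
  -- A node above `1 / 2` without excess flow would put the orbit into its dominance region.
  have hP : ∀ x j, Q x → P x j → l * c j < flow (x j) := by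
    intro x j ⟨hx, hle, heq, hne⟩ hj
    refine lt_of_le_of_ne (hle 0 j) fun he => ?_
    have hj2 : 1 / 2 < x j := by
      by_contra! hlt
      exact (hj hlt).ne he
    obtain ⟨i, hi, hij⟩ := h.exists_ne j
    have hxi : 0 < x i := by
      refine lt_of_le_of_ne (hx.1 i) fun h0 => ?_
      have := (mul_pos hl0 (h.stationary_pos hc hi)).trans_le (hle 0 i)
      simp [flow, ← h0] at this
    have hxj : x j < 1 := by linarith [add_le_one_of_mem_stdSimplex hx hij]
    have hcj : 0 < l * c j := he ▸ flow_pos (by linarith) hxj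
    have hcj' : 0 < c j := pos_of_mul_pos_right hcj hl0.le
    have hjr : j.val < r := by
      by_contra hh
      exact hcj'.ne' (h.stationary_eq_zero hc (not_lt.1 hh))
    have hdom : x ∈ dominanceRegion c j :=
      mem_dominanceRegion_of_le hx hc.1.1 hj2.le he.ge fun i _ _ => hle 0 i
    obtain ⟨i, hi⟩ := hne
    refine hi ?_
    rw [h.flow_eq_of_dominant_const hc hjr hdom (fun k => ?_) i, ← he,
      mul_div_cancel_right₀ _ hcj'.ne']
    have h1 : x j ≤ (dfMap C)^[k] x j :=
      h.monotone_iterate_dominant hc hjr hdom (Nat.zero_le k)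
    by_contra hk
    have h2 : x j < (dfMap C)^[k] x j := lt_of_le_of_ne h1 (Ne.symm hk)
    have h3 := hle k j
    rw [he] at h3
    unfold flow at h3
    nlinarith
  have hself : ∀ x j, Q x → P x j → P (dfMap C x) j := fun x j hQ hj hj2 =>
    h.lt_flow_dfMap hc hQ.1 hl0.le (hQ.2.1 0) j hj2 (Or.inl (hP x j hQ hj))
  have hedge : ∀ x j i, Q x → P x j → 0 < C j i → P (dfMap C x) i := fun x j i hQ hj hji hi2 =>
    h.lt_flow_dfMap hc hQ.1 hl0.le (hQ.2.1 0) i hi2 (Or.inr ⟨j, hP x j hQ hj, hji⟩)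
  have hQ : ∀ x, Q x → Q (dfMap C x) := by
    intro x hQx
    refine ⟨h.dfMap_mem hQx.1, fun k => hQx.2.1 (k + 1), fun k => hQx.2.2.1 (k + 1), ?_⟩
    obtain ⟨j, hj⟩ := hQx.2.2.2
    have hPj : P x j := fun _ => lt_of_le_of_ne (hQx.2.1 0 j) (Ne.symm hj)
    obtain ⟨i, hij, hji⟩ := h.exists_edge j
    by_contra! hcon
    have hi := hedge x j i hQx hPj hji
    have hj' := hself x j hQx hPj
    have h1 : 1 / 2 < dfMap C x i := by
      by_contra! hh
      exact (hi hh).ne' (hcon i)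
    have h2 : 1 / 2 < dfMap C x j := by
      by_contra! hh
      exact (hj' hh).ne' (hcon j)
    linarith [add_le_one_of_mem_stdSimplex (h.dfMap_mem hQx.1) hij]
  have hQx : Q x := ⟨hx, hle, heq, j, hne⟩
  obtain ⟨k, hk⟩ := (h.eventually_of_spreads hQ hself hedge hQx (j := j)
    fun _ => lt_of_le_of_ne (hle 0 j) (Ne.symm hne)).exists
  have hQk : Q ((dfMap C)^[k] x) := by
    clear hk
    induction k with
    | zero => exact hQx
    | succ k ih => rw [Function.iterate_succ_apply']; exact hQ _ ih
  obtain ⟨i, hi, hie⟩ := heq k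
  exact (hP _ i hQk (hk i hi)).ne' hie

/-- Along an orbit that avoids the dominance regions the least ratio of flow to centrality over
the globally reachable nodes is a Lyapunov function, so that its cluster points are equilibria
with positive ratio. -/
lemma clusterPt_of_forall_notMem_dominanceRegion (hc : IsDominantLeftEigenvector C c)
    (hx₀ : x₀ ∈ nonAutocratic n)
    (hnot : ∀ T m, m.val < r → (dfMap C)^[T] x₀ ∉ dominanceRegion c m)
    (hz : MapClusterPt z atTop fun t => (dfMap C)^[t] x₀) :
    ∃ l > 0, ∀ j, flow (z j) = l * c j := by
  have hrn := h.le_card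
  have hr := h.two_le
  have hne : (Finset.univ.filter fun j : Fin n => j.val < r).Nonempty :=
    ⟨⟨0, by omega⟩, by simp; omega⟩
  let L : (Fin n → ℝ) → ℝ := fun x =>
    (Finset.univ.filter fun j : Fin n => j.val < r).inf' hne fun j => flow (x j) / c j
  have hLcont : Continuous L := by
    refine Continuous.finset_inf'_apply hne fun j _ => ?_
    have := continuous_flow
    fun_prop
  have hLle : ∀ {x}, x ∈ stdSimplex ℝ (Fin n) → ∀ {l}, l ≤ L x → ∀ j, l * c j ≤ flow (x j) := by
    intro x hx l hl j
    by_cases hj : j.val < r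
    · rw [← le_div_iff₀ (h.stationary_pos hc hj)]
      exact hl.trans (Finset.inf'_le (fun j => flow (x j) / c j) (by simpa using hj))
    · rw [h.stationary_eq_zero hc (not_lt.1 hj), mul_zero]
      exact flow_nonneg_of_mem_stdSimplex hx j
  have hleL : ∀ {x : Fin n → ℝ} {l}, (∀ j, l * c j ≤ flow (x j)) → l ≤ L x := by
    intro x l hl
    refine Finset.le_inf' _ _ fun j hj => ?_
    rw [le_div_iff₀ (h.stationary_pos hc (by simpa using hj))]
    exact hl j
  have hmem := h.iterate_mem hx₀.1
  obtain ⟨T, hT⟩ := (h.eventually_pos hx₀).exists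
  have hLT : 0 < L ((dfMap C)^[T] x₀) := by
    rw [Finset.lt_inf'_iff]
    intro j hj
    have hj' : j.val < r := by simpa using hj
    exact div_pos (flow_pos (hT j hj') ((h.iterate_mem_nonAutocratic hx₀ T).2 j))
      (h.stationary_pos hc hj')
  have hL0 : ∀ t, 0 ≤ L ((dfMap C)^[t] x₀) := fun t =>
    hleL fun j => by rw [zero_mul]; exact flow_nonneg_of_mem_stdSimplex (hmem t) j
  have hmono : Monotone fun t => L ((dfMap C)^[t] x₀) := by
    refine monotone_nat_of_le_succ fun t => ?_
    rw [Function.iterate_succ_apply']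
    rcases h.le_flow_dfMap_or_mem hc (hmem t) (hL0 t) (hLle (hmem t) le_rfl) with hh | ⟨m, hm, hh⟩
    · exact hleL hh
    · rw [← Function.iterate_succ_apply' (dfMap C)] at hh
      exact absurd hh (hnot _ m hm)
  have hbdd : BddAbove (Set.range fun t => L ((dfMap C)^[t] x₀)) := by
    refine ⟨1 / c ⟨0, by omega⟩, ?_⟩
    rintro _ ⟨t, rfl⟩
    have h0 : (⟨0, by omega⟩ : Fin n).val < r := by simp; omega
    refine (Finset.inf'_le (fun j => flow ((dfMap C)^[t] x₀ j) / c j)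
      (Finset.mem_filter.2 ⟨Finset.mem_univ _, h0⟩)).trans ?_
    refine div_le_div_of_nonneg_right ?_ (hc.1.1 _)
    have := (hmem t).1 ⟨0, by omega⟩
    have := le_one_of_mem_stdSimplex (hmem t) ⟨0, by omega⟩
    unfold flow
    nlinarith
  have key := apply_iterate_of_mapClusterPt hLcont (tendsto_atTop_ciSup hmono hbdd) hz
  have hl0 := hLT.trans_le (le_ciSup hbdd T)
  have hz' : z ∈ stdSimplex ℝ (Fin n) :=
    (isClosed_stdSimplex ℝ (Fin n)).mem_of_mapClusterPt hz (Eventually.of_forall hmem)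
  refine ⟨_, hl0, h.flow_eq_of_least_ratio_const hc hl0 hz'
    (fun k => hLle (h.iterate_mem hz' k) (key k).ge) fun k => ?_⟩
  obtain ⟨j, hj, hje⟩ := Finset.exists_mem_eq_inf' hne fun j => flow ((dfMap C)^[k] z j) / c j
  have hj' : j.val < r := by simpa using hj
  refine ⟨j, hj', ?_⟩
  rw [← key k]
  change _ = (Finset.univ.filter fun j : Fin n => j.val < r).inf' hne
    (fun j => flow ((dfMap C)^[k] z j) / c j) * c j
  rw [hje, div_mul_cancel₀ _ (h.stationary_pos hc hj').ne']

end IsInfluenceNetwork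

/-! ### Equilibria and limits of orbits -/

lemma dfMap_eq_iff : dfMap C x = x ↔ ∀ i, ∑ j, flow (x j) * C j i = flow (x i) := by
  rw [funext_iff]
  refine forall_congr' fun i => ?_
  rw [dfMap_apply]
  constructor <;> intro h <;> linarith

lemma vertices_subset_equilibria (C : Matrix (Fin n) (Fin n) ℝ) : vertices n ⊆ equilibria C := by
  rintro _ ⟨i, rfl⟩
  have h0 : ∀ j, flow ((Pi.single i 1 : Fin n → ℝ) j) = 0 := fun j => by
    by_cases hj : j = i
    · subst hj; simp [flow]
    · simp [flow, Pi.single_eq_of_ne hj]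
  refine ⟨single_mem_stdSimplex ℝ i, dfMap_eq_iff.2 fun j => ?_⟩
  simp [h0]

lemma one_sub_eq_sum_erase (hx : x ∈ stdSimplex ℝ (Fin n)) (i : Fin n) :
    1 - x i = ∑ j ∈ Finset.univ.erase i, x j := by
  rw [← hx.2, ← Finset.add_sum_erase _ _ (Finset.mem_univ i)]
  ring

namespace IsInfluenceNetwork

variable (h : IsInfluenceNetwork r C)
include h

omit h in
lemma dfMap_eq_of_flow_eq (hc : IsDominantLeftEigenvector C c)
    (hx : ∀ j, flow (x j) = l * c j) : dfMap C x = x := by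
  refine dfMap_eq_iff.2 fun i => ?_
  rw [hx, ← stationary_apply hc i, Finset.mul_sum]
  exact Finset.sum_congr rfl fun j _ => by rw [hx]; ring

/-- At an equilibrium the flows form an invariant vector. -/
lemma exists_flow_eq (hc : IsDominantLeftEigenvector C c) (hx : x ∈ nonAutocratic n)
    (hF : dfMap C x = x) : ∃ l > 0, ∀ j, flow (x j) = l * c j := by
  refine ⟨∑ j, flow (x j), ?_, h.eq_smul_stationary hc (dfMap_eq_iff.1 hF)⟩
  obtain ⟨j, hj⟩ := exists_pos_of_mem_stdSimplex hx.1
  exact (flow_pos hj (hx.2 j)).trans_le (Finset.single_le_sum (f := fun j => flow (x j))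
    (fun j _ => flow_nonneg_of_mem_stdSimplex hx.1 j) (Finset.mem_univ j))

lemma pos_of_flow_eq (hc : IsDominantLeftEigenvector C c) (hx : x ∈ stdSimplex ℝ (Fin n))
    (hl : 0 < l) (hxl : ∀ j, flow (x j) = l * c j) {i : Fin n} (hi : i.val < r) : 0 < x i := by
  refine lt_of_le_of_ne (hx.1 i) fun h0 => ?_
  have := mul_pos hl (h.stationary_pos hc hi)
  rw [← hxl, ← h0] at this
  simp [flow] at this

lemma mem_nonAutocratic_of_flow_eq (hc : IsDominantLeftEigenvector C c)
    (hx : x ∈ stdSimplex ℝ (Fin n)) (hl : 0 < l) (hxl : ∀ j, flow (x j) = l * c j) :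
    x ∈ nonAutocratic n := by
  have hrn := h.le_card
  have hr := h.two_le
  refine ⟨hx, fun j => ?_⟩
  by_contra! hj
  have hxj := le_antisymm (le_one_of_mem_stdSimplex hx j) hj
  obtain ⟨i, hi, hij⟩ := h.exists_ne j
  linarith [add_le_one_of_mem_stdSimplex hx hij, h.pos_of_flow_eq hc hx hl hxl hi]

lemma eq_zero_of_flow_eq (hc : IsDominantLeftEigenvector C c) (hx : x ∈ nonAutocratic n)
    (hxl : ∀ j, flow (x j) = l * c j) {i : Fin n} (hi : r ≤ i.val) : x i = 0 := by
  have := hxl i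
  rw [h.stationary_eq_zero hc hi, mul_zero, flow, mul_eq_zero] at this
  rcases this with h0 | h0
  · exact h0
  · linarith [hx.2 i]

omit h in
lemma exists_third (hr : 3 ≤ r) (hrn : r ≤ n) (i j : Fin n) :
    ∃ a : Fin n, a.val < r ∧ a ≠ i ∧ a ≠ j := by
  have hcard : ({i, j} : Finset (Fin n)).card <
      ((Finset.univ : Finset (Fin r)).map (Fin.castLEEmb hrn)).card := by
    rw [Finset.card_map, Finset.card_univ, Fintype.card_fin]
    exact (Finset.card_le_two).trans_lt (by omega)
  obtain ⟨a, ha, ha'⟩ := Finset.exists_mem_notMem_of_card_lt_card hcard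
  simp only [Finset.mem_map, Finset.mem_univ, true_and] at ha
  obtain ⟨b, rfl⟩ := ha
  simp only [Finset.mem_insert, Finset.mem_singleton, not_or] at ha'
  exact ⟨_, by simp, ha'.1, ha'.2⟩

lemma add_lt_one_of_flow_eq (hc : IsDominantLeftEigenvector C c) (hr : 3 ≤ r)
    (hx : x ∈ stdSimplex ℝ (Fin n)) (hl : 0 < l) (hxl : ∀ j, flow (x j) = l * c j)
    {i j : Fin n} (hij : i ≠ j) : x i + x j < 1 := by
  obtain ⟨a, ha, hai, haj⟩ := exists_third hr h.le_card i j
  have h1 : ∑ b ∈ {a, i, j}, x b ≤ ∑ b, x b :=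
    Finset.sum_le_sum_of_subset_of_nonneg (Finset.subset_univ _) fun b _ _ => hx.1 b
  rw [hx.2, Finset.sum_insert (by simp [hai, haj]), Finset.sum_pair hij] at h1
  linarith [h.pos_of_flow_eq hc hx hl hxl ha]

/-- Let `ρ` be the vector of ratios of two equilibria, with maximum at `a` and minimum at `b`.
The flows have a common ratio `κ`, and as `flow (x a) = x a * ∑ j ≠ a, x j`, it is at least
`ρ a * ρ b` by looking at `a`, and at most `ρ a * ρ b` by looking at `b`. The equality cases force
`ρ` to be constant as soon as there are three nodes. -/
lemma eq_of_flow_eq (hc : IsDominantLeftEigenvector C c) (hr : 3 ≤ r)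
    (hx : x ∈ stdSimplex ℝ (Fin n)) (hl : 0 < l) (hxl : ∀ j, flow (x j) = l * c j)
    (hy : y ∈ stdSimplex ℝ (Fin n)) (hl' : 0 < l') (hyl : ∀ j, flow (y j) = l' * c j) :
    y = x := by
  have hrn := h.le_card
  have hxn := h.mem_nonAutocratic_of_flow_eq hc hx hl hxl
  have hyn := h.mem_nonAutocratic_of_flow_eq hc hy hl' hyl
  have hxp : ∀ {i : Fin n}, i.val < r → 0 < x i := h.pos_of_flow_eq hc hx hl hxl
  have hne : (Finset.univ.filter fun j : Fin n => j.val < r).Nonempty :=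
    ⟨⟨0, by omega⟩, by simp; omega⟩
  obtain ⟨a, ha, hamax⟩ := Finset.exists_max_image _ (fun j => y j / x j) hne
  obtain ⟨b, hb, hbmin⟩ := Finset.exists_min_image _ (fun j => y j / x j) hne
  simp only [Finset.mem_filter, Finset.mem_univ, true_and] at ha hb hamax hbmin
  set A := y a / x a with hA
  set B := y b / x b with hB
  have hya : y a = A * x a := by rw [hA, div_mul_cancel₀ _ (hxp ha).ne']
  have hyb : y b = B * x b := by rw [hB, div_mul_cancel₀ _ (hxp hb).ne']
  have hleA : ∀ j, y j ≤ A * x j := fun j => by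
    by_cases hj : j.val < r
    · rw [← div_le_iff₀ (hxp hj)]; exact hamax j hj
    · rw [h.eq_zero_of_flow_eq hc hxn hxl (not_lt.1 hj),
        h.eq_zero_of_flow_eq hc hyn hyl (not_lt.1 hj), mul_zero]
  have hBle : ∀ j, B * x j ≤ y j := fun j => by
    by_cases hj : j.val < r
    · rw [← le_div_iff₀ (hxp hj)]; exact hbmin j hj
    · rw [h.eq_zero_of_flow_eq hc hxn hxl (not_lt.1 hj),
        h.eq_zero_of_flow_eq hc hyn hyl (not_lt.1 hj), mul_zero]
  have hsA : 1 - y a - B * (1 - x a) = ∑ j ∈ Finset.univ.erase a, (y j - B * x j) := by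
    rw [Finset.sum_sub_distrib, ← Finset.mul_sum, ← one_sub_eq_sum_erase hx,
      ← one_sub_eq_sum_erase hy]
  have hsB : A * (1 - x b) - (1 - y b) = ∑ j ∈ Finset.univ.erase b, (A * x j - y j) := by
    rw [Finset.sum_sub_distrib, ← Finset.mul_sum, ← one_sub_eq_sum_erase hx,
      ← one_sub_eq_sum_erase hy]
  have hsA0 : 0 ≤ ∑ j ∈ Finset.univ.erase a, (y j - B * x j) :=
    Finset.sum_nonneg fun j _ => sub_nonneg.2 (hBle j)
  have hsB0 : 0 ≤ ∑ j ∈ Finset.univ.erase b, (A * x j - y j) :=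
    Finset.sum_nonneg fun j _ => sub_nonneg.2 (hleA j)
  have hApos : 0 < A := div_pos (h.pos_of_flow_eq hc hy hl' hyl ha) (hxp ha)
  have hBpos : 0 < B := div_pos (h.pos_of_flow_eq hc hy hl' hyl hb) (hxp hb)
  -- The common ratio of the flows.
  set κ := l' / l with hκ
  have hflow : ∀ j, flow (y j) = κ * flow (x j) := fun j => by
    rw [hxl, hyl, hκ]; field_simp
  have hfa := hflow a
  have hfb := hflow b
  unfold flow at hfa hfb
  rw [hya] at hfa hsA
  rw [hyb] at hfb hsB
  have ha1 : 0 < 1 - x a := sub_pos.2 (hxn.2 a)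
  have hb1 : 0 < 1 - x b := sub_pos.2 (hxn.2 b)
  have hxa := hxp ha
  have hxb := hxp hb
  have hfa' : A * (1 - A * x a) = κ * (1 - x a) := by
    apply mul_left_cancel₀ hxa.ne'; linarith
  have hfb' : B * (1 - B * x b) = κ * (1 - x b) := by
    apply mul_left_cancel₀ hxb.ne'; linarith
  have h1 : A * B ≤ κ := by
    refine le_of_mul_le_mul_right ?_ ha1
    nlinarith
  have h2 : κ ≤ A * B := by
    refine le_of_mul_le_mul_right ?_ hb1
    nlinarith
  have hκAB := le_antisymm h1 h2
  have hsA1 : ∑ j ∈ Finset.univ.erase a, (y j - B * x j) = 0 := by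
    rw [← hsA]
    apply mul_left_cancel₀ hApos.ne'
    rw [← hκAB] at hfa'
    linarith
  have hsB1 : ∑ j ∈ Finset.univ.erase b, (A * x j - y j) = 0 := by
    rw [← hsB]
    apply mul_left_cancel₀ hBpos.ne'
    rw [← hκAB] at hfb'
    linarith
  have heqB := (Finset.sum_eq_zero_iff_of_nonneg fun j _ => sub_nonneg.2 (hBle j)).1 hsA1
  have heqA := (Finset.sum_eq_zero_iff_of_nonneg fun j _ => sub_nonneg.2 (hleA j)).1 hsB1
  obtain ⟨d, hd, hda, hdb⟩ := exists_third hr hrn a b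
  have hAB : A = B := by
    have e1 := heqB d (by simp [hda])
    have e2 := heqA d (by simp [hdb])
    exact mul_right_cancel₀ (hxp hd).ne' (by linarith)
  have hyA : ∀ j, y j = A * x j := fun j => le_antisymm (hleA j) (hAB ▸ hBle j)
  have hA1 : A = 1 := by
    have := hy.2
    rwa [Finset.sum_congr rfl fun j _ => hyA j, ← Finset.mul_sum, hx.2, mul_one] at this
  ext j
  rw [hyA, hA1, one_mul]

/-- At an equilibrium other than a vertex, self-weights are ranked as centralities. -/
lemma le_iff_of_flow_eq (hc : IsDominantLeftEigenvector C c) (hr : 3 ≤ r)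
    (hx : x ∈ stdSimplex ℝ (Fin n)) (hl : 0 < l) (hxl : ∀ j, flow (x j) = l * c j)
    (i j : Fin n) : x i ≤ x j ↔ c i ≤ c j := by
  by_cases hij : i = j
  · simp [hij]
  have h1 := h.add_lt_one_of_flow_eq hc hr hx hl hxl hij
  have h2 : (x j - x i) * (1 - x i - x j) = l * (c j - c i) := by
    rw [mul_sub l, ← hxl, ← hxl]; unfold flow; ring
  constructor
  · intro hle
    have := mul_nonneg (sub_nonneg.2 hle) (by linarith : 0 ≤ 1 - x i - x j)
    rw [h2] at this
    linarith [nonneg_of_mul_nonneg_right this hl]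
  · intro hle
    have := mul_nonneg hl.le (sub_nonneg.2 hle)
    rw [← h2] at this
    linarith [nonneg_of_mul_nonneg_left this (by linarith : 0 < 1 - x i - x j)]

lemma stationary_center (hc : IsDominantLeftEigenvector C c) {k : Fin n}
    (hstar : ∀ i j : Fin n, i.val < r → j.val < r → 0 < C i j → i = k ∨ j = k) : c k = 1 / 2 := by
  have hCk : ∀ i, i ≠ k → i.val < r → C i k = 1 := fun i hik hi => by
    rw [← h.row_sum i]
    refine (Finset.sum_eq_single k (fun j _ hj => ?_) (by simp)).symm
    by_contra hne
    have hpos := lt_of_le_of_ne (h.nonneg i j) (Ne.symm hne)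
    rcases hstar i j hi (h.closed i j hi hpos) hpos with hh | hh
    exacts [hik hh, hj hh]
  have h1 := stationary_apply hc k
  have h2 := one_sub_eq_sum_erase hc.1 k
  rw [← Finset.add_sum_erase _ _ (Finset.mem_univ k), h.diag, mul_zero, zero_add] at h1
  have h3 : ∑ i ∈ Finset.univ.erase k, c i * C i k = ∑ i ∈ Finset.univ.erase k, c i := by
    refine Finset.sum_congr rfl fun i hi => ?_
    by_cases hir : i.val < r
    · rw [hCk i (Finset.ne_of_mem_erase hi) hir, mul_one]
    · rw [h.stationary_eq_zero hc (not_lt.1 hir), zero_mul]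
  linarith

lemma stationary_lt_half (hc : IsDominantLeftEigenvector C c)
    (hstar : ¬ ∃ k : Fin n, k.val < r ∧
      ∀ i j : Fin n, i.val < r → j.val < r → 0 < C i j → i = k ∨ j = k) (k : Fin n) :
    c k < 1 / 2 := by
  by_cases hk : k.val < r
  swap
  · rw [h.stationary_eq_zero hc (not_lt.1 hk)]; norm_num
  by_contra! hcon
  refine hstar ⟨k, hk, fun i j hi hj hij => ?_⟩
  by_contra! hne
  have h1 := stationary_apply hc k
  have h2 := one_sub_eq_sum_erase hc.1 k
  rw [← Finset.add_sum_erase _ _ (Finset.mem_univ k), h.diag, mul_zero, zero_add] at h1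
  have hCik : C i k < 1 := by
    rw [← h.row_sum i]
    have := Finset.sum_le_sum_of_subset_of_nonneg (Finset.subset_univ {k, j})
      fun l _ _ => h.nonneg i l
    rw [Finset.sum_pair hne.2.symm] at this
    linarith
  have h3 : ∑ i ∈ Finset.univ.erase k, c i * C i k < ∑ i ∈ Finset.univ.erase k, c i := by
    refine Finset.sum_lt_sum (fun l _ => mul_le_of_le_one_right (hc.1.1 l) (h.le_one l k))
      ⟨i, by simp [hne.1], ?_⟩
    exact mul_lt_of_lt_one_right (h.stationary_pos hc hi) hCik
  linarith

/-- For a star with at least three nodes, `a = 1 - x k` would satisfy `a² = ∑ j ≠ k, x j ²`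
although `a = ∑ j ≠ k, x j` has several positive terms. -/
lemma not_flow_eq_of_center (hc : IsDominantLeftEigenvector C c) (hr : 3 ≤ r) {k : Fin n}
    (hk : c k = 1 / 2) (hx : x ∈ stdSimplex ℝ (Fin n)) (hl : 0 < l) :
    ¬ ∀ j, flow (x j) = l * c j := by
  intro hxl
  have ha := one_sub_eq_sum_erase hx k
  have hsum : ∑ j ∈ Finset.univ.erase k, x j * (1 - x k - x j) = 0 := by
    have h1 : ∑ j ∈ Finset.univ.erase k, flow (x j) = flow (x k) := by
      rw [Finset.sum_congr rfl fun j _ => hxl j, ← Finset.mul_sum,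
        ← one_sub_eq_sum_erase hc.1, hxl, hk]
      ring
    have h2 : ∑ j ∈ Finset.univ.erase k, x j * (1 - x k - x j) =
        ∑ j ∈ Finset.univ.erase k, (flow (x j) - x j * x k) :=
      Finset.sum_congr rfl fun j _ => by unfold flow; ring
    rw [h2, Finset.sum_sub_distrib, h1, ← Finset.sum_mul, ← ha]
    unfold flow; ring
  have hnn : ∀ j ∈ Finset.univ.erase k, 0 ≤ x j * (1 - x k - x j) := fun j hj =>
    mul_nonneg (hx.1 j) (by linarith [add_le_one_of_mem_stdSimplex hx (Finset.ne_of_mem_erase hj)])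
  have h0 := (Finset.sum_eq_zero_iff_of_nonneg hnn).1 hsum
  obtain ⟨i, hi, hik, -⟩ := exists_third hr h.le_card k k
  have h1 := h.add_lt_one_of_flow_eq hc hr hx hl hxl hik
  exact (mul_pos (h.pos_of_flow_eq hc hx hl hxl hi) (by linarith : 0 < 1 - x k - x i)).ne'
    (h0 i (by simp [hik]))

omit h in
/-- A dominant node of centrality below `1 / 2` stays away from self-weight `1`. -/
lemma le_of_mem_dominanceRegion {m : Fin n} (hcm : 0 < c m) (hc2 : c m < 1 / 2)
    (hc : IsDominantLeftEigenvector C c) (hx : x ∈ dominanceRegion c m) (hx1 : x m < 1) :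
    x m ≤ c m / (1 - c m) := by
  have hl := le_flow_of_mem_dominanceRegion hcm hx
  have h1 : flow (x m) / c m * (1 - c m) ≤ 1 - x m := by
    rw [one_sub_eq_sum_erase hc.1, one_sub_eq_sum_erase hx.1, Finset.mul_sum]
    refine Finset.sum_le_sum fun j _ => (hl j).trans ?_
    unfold flow
    nlinarith [hx.1.1 j]
  rw [le_div_iff₀ (by linarith)]
  rw [div_mul_eq_mul_div, div_le_iff₀ hcm] at h1
  refine le_of_mul_le_mul_left ?_ (sub_pos.2 hx1)
  unfold flow at h1
  linarith

lemma mapClusterPt_mem_stdSimplex (hx₀ : x₀ ∈ stdSimplex ℝ (Fin n))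
    (hz : MapClusterPt z atTop fun t => (dfMap C)^[t] x₀) : z ∈ stdSimplex ℝ (Fin n) :=
  (isClosed_stdSimplex ℝ (Fin n)).mem_of_mapClusterPt hz
    (Eventually.of_forall fun t => h.iterate_mem hx₀ t)

lemma tendsto_of_forall_mapClusterPt (hx₀ : x₀ ∈ stdSimplex ℝ (Fin n))
    (hu : ∀ z, MapClusterPt z atTop (fun t => (dfMap C)^[t] x₀) → z = y) :
    Tendsto (fun t => (dfMap C)^[t] x₀) atTop (𝓝 y) :=
  (isCompact_stdSimplex ℝ (Fin n)).tendsto_nhds_of_unique_mapClusterPt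
    (Eventually.of_forall fun t => h.iterate_mem hx₀ t) fun z _ hz => hu z hz

/-- In the star case only the dominance region of the center contains non-vertices, and there is
no equilibrium with positive ratio of flow to centrality. -/
theorem tendsto_center (hc : IsDominantLeftEigenvector C c) (hr : 3 ≤ r) {k : Fin n}
    (hk : c k = 1 / 2) (hx₀ : x₀ ∈ nonAutocratic n) :
    Tendsto (fun t => (dfMap C)^[t] x₀) atTop (𝓝 (Pi.single k 1)) := by
  refine h.tendsto_of_forall_mapClusterPt hx₀.1 fun z hz => ?_
  have hzs := h.mapClusterPt_mem_stdSimplex hx₀.1 hz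
  by_cases hdom : ∃ T m, m.val < r ∧ (dfMap C)^[T] x₀ ∈ dominanceRegion c m
  · obtain ⟨T, m, hm, hT⟩ := hdom
    have hcm := h.stationary_pos hc hm
    obtain ⟨hzm, hzf⟩ := h.clusterPt_of_mem_dominanceRegion hc hm hT hz
    have hzm1 : 1 ≤ z m := by
      by_contra! hlt
      refine h.not_flow_eq_of_center hc hr hk hzs ?_ hzf
      exact div_pos (flow_pos (by linarith [hzm.2.1]) hlt) hcm
    rw [eq_single_of_mem_stdSimplex hzs hzm1]
    suffices m = k by rw [this]
    by_contra hmk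
    obtain ⟨i, hi, him, hik⟩ := exists_third hr h.le_card m k
    have hcm2 : c m < c k := by
      have h1 := Finset.sum_le_sum_of_subset_of_nonneg (Finset.subset_univ {i, m, k})
        fun l _ _ => hc.1.1 l
      rw [hc.1.2, Finset.sum_insert (by simp [him, hik]), Finset.sum_pair hmk] at h1
      linarith [h.stationary_pos hc hi]
    have hx := h.iterate_mem_nonAutocratic hx₀ T
    have h1 := add_le_one_of_mem_stdSimplex hT.1 (Ne.symm hmk)
    have h2 := hT.2.2 k
    have h3 : flow ((dfMap C)^[T] x₀ k) ≤ flow ((dfMap C)^[T] x₀ m) := by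
      unfold flow
      nlinarith [hT.2.1]
    have h4 := flow_pos (by linarith [hT.2.1]) (hx.2 m)
    nlinarith
  · push Not at hdom
    obtain ⟨l, hl, hzl⟩ := h.clusterPt_of_forall_notMem_dominanceRegion hc hx₀ hdom hz
    exact absurd hzl (h.not_flow_eq_of_center hc hr hk hzs hl)

lemma exists_flow_eq_of_mapClusterPt (hc : IsDominantLeftEigenvector C c)
    (hc2 : ∀ k, c k < 1 / 2) (hx₀ : x₀ ∈ nonAutocratic n)
    (hz : MapClusterPt z atTop fun t => (dfMap C)^[t] x₀) :
    ∃ l > 0, ∀ j, flow (z j) = l * c j := by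
  by_cases hdom : ∃ T m, m.val < r ∧ (dfMap C)^[T] x₀ ∈ dominanceRegion c m
  · obtain ⟨T, m, hm, hT⟩ := hdom
    have hcm := h.stationary_pos hc hm
    obtain ⟨hzm, hzf⟩ := h.clusterPt_of_mem_dominanceRegion hc hm hT hz
    have hle : z m ≤ c m / (1 - c m) := by
      refine (isClosed_le (continuous_apply m) continuous_const).mem_of_mapClusterPt hz
        (eventually_atTop.2 ⟨T, fun t ht => ?_⟩)
      obtain ⟨k, rfl⟩ := Nat.exists_eq_add_of_le' ht
      have hx := (h.iterate_mem_nonAutocratic hx₀ (k + T)).2 m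
      rw [Function.iterate_add_apply] at hx ⊢
      exact le_of_mem_dominanceRegion hcm (hc2 m) hc
        (h.iterate_mem_dominanceRegion hc hm hT k) hx
    have hlt : c m / (1 - c m) < 1 := by
      have := hc2 m
      rw [div_lt_one (by linarith)]; linarith
    exact ⟨_, div_pos (flow_pos (by linarith [hzm.2.1]) (by linarith)) hcm, hzf⟩
  · push Not at hdom
    exact h.clusterPt_of_forall_notMem_dominanceRegion hc hx₀ hdom hz

/-- Without a node of centrality `1 / 2`, the interior equilibrium arises as a cluster point of
an arbitrary orbit; by its uniqueness it attracts all orbits outside the vertices. -/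
theorem exists_tendsto (hc : IsDominantLeftEigenvector C c) (hr : 3 ≤ r)
    (hc2 : ∀ k, c k < 1 / 2) : ∃ xs ∈ stdSimplex ℝ (Fin n), ∃ l > 0,
      (∀ j, flow (xs j) = l * c j) ∧ ∀ x₀ ∈ nonAutocratic n,
        Tendsto (fun t => (dfMap C)^[t] x₀) atTop (𝓝 xs) := by
  have hcn : c ∈ nonAutocratic n := ⟨hc.1, fun j => by linarith [hc2 j]⟩
  obtain ⟨xs, hxs, hcl⟩ := (isCompact_stdSimplex ℝ (Fin n)).exists_mapClusterPt_of_frequently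
    (l := atTop) (f := fun t => (dfMap C)^[t] c)
    (Frequently.of_forall fun t => h.iterate_mem hcn.1 t)
  obtain ⟨l, hl, hxl⟩ := h.exists_flow_eq_of_mapClusterPt hc hc2 hcn hcl
  refine ⟨xs, hxs, l, hl, hxl, fun x₀ hx₀ => h.tendsto_of_forall_mapClusterPt hx₀.1
    fun z hz => ?_⟩
  obtain ⟨l', hl', hzl⟩ := h.exists_flow_eq_of_mapClusterPt hc hc2 hx₀ hz
  exact h.eq_of_flow_eq hc hr hxs hl hxl (h.mapClusterPt_mem_stdSimplex hx₀.1 hz) hl' hzl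

end IsInfluenceNetwork

/-! ### Two contraction criteria for nonnegative matrices -/

/-- Doeblin's argument: a column-stochastic matrix some power of which has a positive row
contracts the `ℓ¹` norm on vectors of sum zero. -/
lemma tendsto_pow_mulVec_of_row_pos {n : ℕ} {A : Matrix (Fin n) (Fin n) ℝ}
    (hA : ∀ i j, 0 ≤ A i j) (hsum : ∀ j, ∑ i, A i j = 1) {m : Fin n}
    (hpos : ∀ l, ∀ᶠ k in atTop, 0 < (A ^ k) m l) {d : Fin n → ℝ} (hd : ∑ i, d i = 0) :
    Tendsto (fun t => A ^ t *ᵥ d) atTop (𝓝 0) := by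
  have hpow : ∀ k : ℕ, (∀ i j, 0 ≤ (A ^ k) i j) ∧ ∀ j, ∑ i, (A ^ k) i j = 1 := by
    intro k
    induction k with
    | zero =>
      refine ⟨fun i j => ?_, fun j => ?_⟩
      · rw [pow_zero, Matrix.one_apply]; split_ifs <;> norm_num
      · simp [Matrix.one_apply]
    | succ k ih =>
      refine ⟨fun i j => ?_, fun j => ?_⟩
      · rw [pow_succ, Matrix.mul_apply]
        exact Finset.sum_nonneg fun l _ => mul_nonneg (ih.1 i l) (hA l j)
      · simp only [pow_succ, Matrix.mul_apply]
        rw [Finset.sum_comm]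
        simp only [← Finset.sum_mul, ih.2, one_mul, hsum]
  have hzero : ∀ (P : Matrix (Fin n) (Fin n) ℝ), (∀ j, ∑ i, P i j = 1) → ∀ d : Fin n → ℝ,
      ∑ i, (P *ᵥ d) i = ∑ i, d i := by
    intro P hP d
    simp only [Matrix.mulVec, dotProduct]
    rw [Finset.sum_comm]
    simp only [← Finset.sum_mul, hP, one_mul]
  obtain ⟨N, hN0, hN⟩ : ∃ N : ℕ, 0 < N ∧ ∀ l, 0 < (A ^ N) m l :=
    ((eventually_gt_atTop 0).and (eventually_all.2 hpos)).exists
  have : Nonempty (Fin n) := ⟨m⟩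
  obtain ⟨l₀, hl₀⟩ := Finite.exists_min fun l => (A ^ N) m l
  set ε := (A ^ N) m l₀ with hε
  have hε0 : 0 < ε := hN l₀
  have hε1 : ε ≤ 1 := by
    rw [← (hpow N).2 l₀]
    exact Finset.single_le_sum (f := fun i => (A ^ N) i l₀) (fun i _ => (hpow N).1 i l₀)
      (Finset.mem_univ m)
  have hbound : ∀ (P : Matrix (Fin n) (Fin n) ℝ) (η : ℝ), (∀ i j, 0 ≤ P i j) →
      (∀ j, ∑ i, P i j = 1) → (∀ l, η ≤ P m l) → ∀ d : Fin n → ℝ, ∑ i, d i = 0 →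
      ∑ i, |(P *ᵥ d) i| ≤ (1 - η) * ∑ i, |d i| := by
    intro P η hP hPs hη d hd
    have h1 : ∀ i, |(P *ᵥ d) i| ≤ ∑ l, (P i l - if i = m then η else 0) * |d l| := by
      intro i
      have e : (P *ᵥ d) i = ∑ l, (P i l - if i = m then η else 0) * d l := by
        simp only [sub_mul, Finset.sum_sub_distrib, ← Finset.mul_sum, hd, mul_zero, sub_zero,
          Matrix.mulVec, dotProduct]
      rw [e]
      refine (Finset.abs_sum_le_sum_abs _ _).trans (Finset.sum_le_sum fun l _ => ?_)
      rw [abs_mul, abs_of_nonneg]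
      split_ifs with him
      · rw [him]; linarith [hη l]
      · linarith [hP i l]
    refine (Finset.sum_le_sum fun i _ => h1 i).trans (le_of_eq ?_)
    rw [Finset.sum_comm, Finset.mul_sum]
    refine Finset.sum_congr rfl fun l _ => ?_
    rw [← Finset.sum_mul, Finset.sum_sub_distrib, hPs]
    simp
  have hanti : Antitone fun t => ∑ i, |(A ^ t *ᵥ d) i| := by
    refine antitone_nat_of_succ_le fun t => ?_
    have := hbound A 0 hA hsum (fun l => hA m l) (A ^ t *ᵥ d)
      (by rw [hzero _ (hpow t).2, hd])
    rwa [sub_zero, one_mul, Matrix.mulVec_mulVec, ← pow_succ'] at this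
  have hsub : ∀ k : ℕ, ∑ i, |(A ^ (N * k) *ᵥ d) i| ≤ (1 - ε) ^ k * ∑ i, |d i| := by
    intro k
    induction k with
    | zero => simp
    | succ k ih =>
      have := hbound (A ^ N) ε (hpow N).1 (hpow N).2 hl₀ (A ^ (N * k) *ᵥ d)
        (by rw [hzero _ (hpow _).2, hd])
      rw [Matrix.mulVec_mulVec, ← pow_add] at this
      rw [Nat.mul_succ, add_comm, pow_succ', mul_assoc]
      exact this.trans (mul_le_mul_of_nonneg_left ih (by linarith))
  have hlim : Tendsto (fun t => ∑ i, |(A ^ t *ᵥ d) i|) atTop (𝓝 0) := by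
    rw [tendsto_iff_tendsto_subseq_of_antitone hanti
      (tendsto_id.const_mul_atTop' hN0 : Tendsto (fun k => N * k) atTop atTop)]
    refine squeeze_zero (fun k => Finset.sum_nonneg fun i _ => abs_nonneg _) hsub ?_
    simpa using (tendsto_pow_atTop_nhds_zero_of_lt_one (by linarith)
      (by linarith : 1 - ε < 1)).mul_const (∑ i, |d i|)
  rw [tendsto_pi_nhds]
  intro i
  refine squeeze_zero_norm (fun t => ?_) hlim
  exact Finset.single_le_sum (f := fun i => |(A ^ t *ᵥ d) i|) (fun i _ => abs_nonneg _)
    (Finset.mem_univ i)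

/-- A nonnegative matrix without nonzero nonnegative subinvariant vectors contracts a weighted sup
norm. The weight is the sum of the series `∑ Bᵏ 1`, whose partial sums `S` satisfy
`S - B S ≤ 1`; compactness of the simplex turns this into a bound on `S`. -/
lemma exists_weight_of_forall_subinvariant {n : ℕ} {B : Matrix (Fin n) (Fin n) ℝ} (m : Fin n)
    (hB : ∀ i j, 0 ≤ B i j)
    (hsub : ∀ M : Fin n → ℝ, (∀ i, 0 ≤ M i) → (∀ i, M i ≤ (B *ᵥ M) i) → M = 0) :
    ∃ v : Fin n → ℝ, (∀ i, 0 < v i) ∧ ∃ ρ : ℝ, 0 ≤ ρ ∧ ρ < 1 ∧ ∀ i, (B *ᵥ v) i ≤ ρ * v i := by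
  have hmono : ∀ {u w : Fin n → ℝ}, (∀ i, u i ≤ w i) → ∀ i, (B *ᵥ u) i ≤ (B *ᵥ w) i :=
    fun hu i => by
      simp only [Matrix.mulVec, dotProduct]
      exact Finset.sum_le_sum fun j _ => mul_le_mul_of_nonneg_left (hu j) (hB i j)
  let S : ℕ → Fin n → ℝ := fun t => (fun w => 1 + B *ᵥ w)^[t] 0
  have hS : ∀ t i, S (t + 1) i = 1 + (B *ᵥ S t) i := fun t i => by
    simp only [S, Function.iterate_succ_apply']
    rfl
  have hSnn : ∀ t i, 0 ≤ S t i := by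
    intro t
    induction t with
    | zero => exact fun i => le_rfl
    | succ t ih =>
      intro i
      rw [hS]
      have := hmono (u := 0) ih i
      rw [Matrix.mulVec_zero] at this
      exact add_nonneg zero_le_one this
  have hSmono : ∀ t i, S t i ≤ S (t + 1) i := by
    intro t
    induction t with
    | zero => exact fun i => hSnn 1 i
    | succ t ih =>
      intro i
      rw [hS, hS (t + 1)]
      linarith [hmono ih i]
  let g : (Fin n → ℝ) → ℝ := fun M => ∑ i, max (M i - (B *ᵥ M) i) 0
  have hgcont : Continuous g := by
    have : Continuous fun M : Fin n → ℝ => B *ᵥ M := by fun_prop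
    fun_prop
  obtain ⟨M₀, hM₀, hmin⟩ := (isCompact_stdSimplex ℝ (Fin n)).exists_isMinOn
    ⟨_, single_mem_stdSimplex ℝ m⟩ hgcont.continuousOn
  have hg0 : 0 < g M₀ := by
    refine lt_of_le_of_ne (Finset.sum_nonneg fun i _ => le_max_right _ _) fun h0 => ?_
    have h1 := (Finset.sum_eq_zero_iff_of_nonneg fun i _ => le_max_right _ _).1 h0.symm
    have h2 := hsub M₀ hM₀.1 fun i => by
      have := max_eq_right_iff.1 (h1 i (Finset.mem_univ i))
      linarith
    have h3 := hM₀.2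
    simp [h2] at h3
  have hbound : ∀ t, ∑ i, S t i ≤ n / g M₀ := by
    intro t
    rw [le_div_iff₀ hg0]
    rcases (Finset.sum_nonneg fun i _ => hSnn t i).eq_or_lt with h0 | hpos
    · rw [← h0, zero_mul]; positivity
    · set s := ∑ i, S t i with hs
      have hmem : s⁻¹ • S t ∈ stdSimplex ℝ (Fin n) := by
        refine ⟨fun i => mul_nonneg (inv_nonneg.2 hpos.le) (hSnn t i), ?_⟩
        simp only [Pi.smul_apply, smul_eq_mul, ← Finset.mul_sum]
        exact inv_mul_cancel₀ hpos.ne'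
      have h1 : g M₀ ≤ g (s⁻¹ • S t) := hmin hmem
      have h2 : g (s⁻¹ • S t) ≤ s⁻¹ * n := by
        have : ∀ i, max ((s⁻¹ • S t) i - (B *ᵥ (s⁻¹ • S t)) i) 0 ≤ s⁻¹ := by
          intro i
          refine max_le ?_ (inv_nonneg.2 hpos.le)
          rw [Matrix.mulVec_smul, Pi.smul_apply, Pi.smul_apply, smul_eq_mul, smul_eq_mul,
            ← mul_sub]
          refine mul_le_of_le_one_right (inv_nonneg.2 hpos.le) ?_
          linarith [hSmono t i, hS t i]
        calc g (s⁻¹ • S t) ≤ ∑ _i : Fin n, s⁻¹ := Finset.sum_le_sum fun i _ => this i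
          _ = s⁻¹ * n := by simp [mul_comm]
      calc s * g M₀ ≤ s * (s⁻¹ * n) := mul_le_mul_of_nonneg_left (h1.trans h2) hpos.le
        _ = n := by rw [← mul_assoc, mul_inv_cancel₀ hpos.ne', one_mul]
  have hbdd : ∀ i, BddAbove (Set.range fun t => S t i) := fun i => by
    refine ⟨n / g M₀, ?_⟩
    rintro _ ⟨t, rfl⟩
    exact (Finset.single_le_sum (fun i _ => hSnn t i) (Finset.mem_univ i)).trans (hbound t)
  let v : Fin n → ℝ := fun i => ⨆ t, S t i
  have hlim : ∀ i, Tendsto (fun t => S t i) atTop (𝓝 (v i)) := fun i =>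
    tendsto_atTop_ciSup (monotone_nat_of_le_succ fun t => hSmono t i) (hbdd i)
  have hv : ∀ i, v i = 1 + (B *ᵥ v) i := by
    intro i
    refine tendsto_nhds_unique ((tendsto_add_atTop_iff_nat 1).2 (hlim i)) ?_
    simp only [hS, Matrix.mulVec, dotProduct]
    exact (tendsto_finsetSum _ fun j _ => (hlim j).const_mul (B i j)).const_add 1
  have hv1 : ∀ i, 1 ≤ v i := fun i => by
    refine le_trans ?_ (le_ciSup (hbdd i) 1)
    have := hS 0 i
    have h0 : (B *ᵥ S 0) i = 0 := by
      have : S 0 = 0 := rfl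
      rw [this, Matrix.mulVec_zero]; rfl
    simp only [zero_add] at this
    rw [this, h0]; linarith
  have hV : ∀ i, v i ≤ ∑ j, v j := fun i =>
    Finset.single_le_sum (fun j _ => zero_le_one.trans (hv1 j)) (Finset.mem_univ i)
  have hVpos : 1 ≤ ∑ j, v j := (hv1 m).trans (hV m)
  refine ⟨v, fun i => zero_lt_one.trans_le (hv1 i), 1 - (∑ j, v j)⁻¹, ?_, ?_, fun i => ?_⟩
  · linarith [inv_le_one_of_one_le₀ hVpos]
  · linarith [inv_pos.2 (zero_lt_one.trans_le hVpos)]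
  · have h1 : (∑ j, v j)⁻¹ * v i ≤ 1 := by
      rw [inv_mul_le_iff₀ (by linarith), mul_one]; exact hV i
    rw [sub_mul, one_mul]
    linarith [hv i]

/-! ### Linear stability of the interior equilibrium -/

/-- The Jacobian of the model at `x`, with entries `2 xᵢ δᵢⱼ + Cⱼᵢ (1 - 2 xⱼ)`. -/
def jacobian {n : ℕ} (C : Matrix (Fin n) (Fin n) ℝ) (x : Fin n → ℝ) :
    Matrix (Fin n) (Fin n) ℝ :=
  fun i j => (if i = j then 2 * x i else 0) + C j i * (1 - 2 * x j)

lemma jacobian_mulVec_apply (C : Matrix (Fin n) (Fin n) ℝ) (x d : Fin n → ℝ) (i : Fin n) :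
    (jacobian C x *ᵥ d) i = 2 * x i * d i + ∑ j, C j i * (1 - 2 * x j) * d j := by
  simp [jacobian, Matrix.mulVec, dotProduct, add_mul, Finset.sum_add_distrib]

lemma hasDerivAt_flow (u : ℝ) : HasDerivAt flow (1 - 2 * u) u := by
  have := (hasDerivAt_id u).mul ((hasDerivAt_id u).const_sub 1)
  simp only [id_eq, one_mul, mul_neg, mul_one] at this
  exact this.congr_deriv (by ring)

lemma hasFDerivAt_dfMap (C : Matrix (Fin n) (Fin n) ℝ) (x : Fin n → ℝ) :
    HasFDerivAt (dfMap C) (Matrix.mulVecLin (jacobian C x)).toContinuousLinearMap x := by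
  rw [hasFDerivAt_pi']
  intro i
  have hp : ∀ j, HasFDerivAt (fun y : Fin n → ℝ => y j)
      (ContinuousLinearMap.proj (R := ℝ) (φ := fun _ : Fin n => ℝ) j) x := fun j =>
    (ContinuousLinearMap.proj (R := ℝ) (φ := fun _ : Fin n => ℝ) j).hasFDerivAt
  have hf : ∀ j, HasFDerivAt (flow ∘ fun y : Fin n → ℝ => y j) ((1 - 2 * x j) •
      ContinuousLinearMap.proj (R := ℝ) (φ := fun _ : Fin n => ℝ) j) x := fun j =>
    (hasDerivAt_flow (x j)).comp_hasFDerivAt x (hp j)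
  have := ((hp i).sub (hf i)).add (HasFDerivAt.fun_sum fun j (_ : j ∈ Finset.univ) =>
    (hf j).mul_const (C j i))
  refine (this.congr_of_eventuallyEq
    (Eventually.of_forall fun y => dfMap_apply C y i)).congr_fderiv ?_
  ext d
  simp [jacobian_mulVec_apply]
  simp only [← mul_assoc]
  ring

namespace IsInfluenceNetwork

variable (h : IsInfluenceNetwork r C)
include h

lemma sum_jacobian (x : Fin n → ℝ) (j : Fin n) : ∑ i, jacobian C x i j = 1 := by
  simp [jacobian, Finset.sum_add_distrib, ← Finset.sum_mul, h.row_sum]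

lemma sum_jacobian_mulVec (x d : Fin n → ℝ) : ∑ i, (jacobian C x *ᵥ d) i = ∑ i, d i := by
  simp only [Matrix.mulVec, dotProduct]
  rw [Finset.sum_comm]
  simp only [← Finset.sum_mul, h.sum_jacobian, one_mul]

/-- If all self-weights are at most `1 / 2`, the Jacobian is a stochastic matrix. Its digraph leads
every node to `m`. -/
lemma tendsto_jacobian_pow_of_le_half (hx : ∀ i, 0 ≤ x i) {m : Fin n} (hm : m.val < r)
    (hxm : 0 < x m) (hx2 : x m ≤ 1 / 2) (hlt : ∀ i, i ≠ m → x i < 1 / 2) {d : Fin n → ℝ}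
    (hd : ∑ i, d i = 0) : Tendsto (fun t => jacobian C x ^ t *ᵥ d) atTop (𝓝 0) := by
  have hle : ∀ i, x i ≤ 1 / 2 := fun i => by
    by_cases hi : i = m
    · rw [hi]; exact hx2
    · exact (hlt i hi).le
  have hJ : ∀ i j, 0 ≤ jacobian C x i j := fun i j => by
    refine add_nonneg ?_ (mul_nonneg (h.nonneg j i) (by linarith [hle j]))
    split_ifs
    · linarith [hx i]
    · exact le_rfl
  have hJpow : ∀ k : ℕ, ∀ i j, 0 ≤ (jacobian C x ^ k) i j := fun k => by
    induction k with
    | zero => intro i j; rw [pow_zero, Matrix.one_apply]; split_ifs <;> norm_num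
    | succ k ih =>
      intro i j
      rw [pow_succ, Matrix.mul_apply]
      exact Finset.sum_nonneg fun l _ => mul_nonneg (ih i l) (hJ l j)
  have hstep : ∀ (k : ℕ) (a b : Fin n), 0 < (jacobian C x ^ k) m b → 0 < jacobian C x b a →
      0 < (jacobian C x ^ (k + 1)) m a := fun k a b h1 h2 => by
    rw [pow_succ, Matrix.mul_apply]
    exact (mul_pos h1 h2).trans_le (Finset.single_le_sum
      (f := fun l => (jacobian C x ^ k) m l * jacobian C x l a)
      (fun l _ => mul_nonneg (hJpow k m l) (hJ l a)) (Finset.mem_univ b))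
  have hmm : ∀ k : ℕ, 0 < (jacobian C x ^ k) m m := fun k => by
    induction k with
    | zero => simp
    | succ k ih =>
      refine hstep k m m ih ?_
      simpa [jacobian, h.diag] using hxm
  refine tendsto_pow_mulVec_of_row_pos hJ (h.sum_jacobian x) (m := m) (fun i => ?_) hd
  have hpath := h.reach i m hm
  induction hpath using Relation.ReflTransGen.head_induction_on with
  | refl => exact Eventually.of_forall hmm
  | @head a b hab _ ih =>
    by_cases ham : a = m
    · rw [ham]; exact Eventually.of_forall hmm
    · obtain ⟨K, hK⟩ := eventually_atTop.1 ih
      refine eventually_atTop.2 ⟨K + 1, fun k hk => ?_⟩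
      obtain ⟨k, rfl⟩ := Nat.exists_eq_add_of_le' (Nat.one_le_of_lt hk)
      refine hstep k a b (hK k (by omega)) ?_
      have hba : b ≠ a := fun hh => by rw [hh, h.diag] at hab; exact hab.false
      have := mul_pos hab (by linarith [hlt a ham] : 0 < 1 - 2 * x a)
      simpa [jacobian, hba] using this

/-- If `x m > 1 / 2`, the variable `x m = 1 - ∑ j ≠ m, x j` is eliminated: the Jacobian of the
remaining system is nonnegative. With `a = 1 - x m`, a subinvariant vector of it would be
dominated by a multiple of the velocity `c j / (1 - 2 x j)` of the branch of solutions of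
`flow (x j) = l * c j`, contrary to `∑ j ≠ m, flow (x j) / (1 - 2 x j) < flow a / (1 - 2 a)`. -/
lemma tendsto_jacobian_pow_of_half_lt (hc : IsDominantLeftEigenvector C c) (hr : 3 ≤ r)
    (hx : x ∈ stdSimplex ℝ (Fin n)) (hl : 0 < l) (hxl : ∀ j, flow (x j) = l * c j)
    {m : Fin n} (hm : m.val < r) (hm2 : 1 / 2 < x m) {d : Fin n → ℝ}
    (hd : ∑ i, d i = 0) : Tendsto (fun t => jacobian C x ^ t *ᵥ d) atTop (𝓝 0) := by
  have hcm := h.stationary_pos hc hm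
  have hxm1 := (h.mem_nonAutocratic_of_flow_eq hc hx hl hxl).2 m
  have hadd : ∀ i, i ≠ m → x i < 1 - x m := fun i hi => by
    linarith [h.add_lt_one_of_flow_eq hc hr hx hl hxl hi]
  have hx2 : ∀ i, i ≠ m → 0 < 1 - 2 * x i := fun i hi => by linarith [hadd i hi]
  -- The Jacobian of the system without `x m`, padded by zeros.
  let B : Matrix (Fin n) (Fin n) ℝ := fun i j => if i = m ∨ j = m then 0 else
    (if i = j then 2 * x i else 0) + C j i * (1 - 2 * x j) + C m i * (2 * x m - 1)
  have hB : ∀ i j, 0 ≤ B i j := fun i j => by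
    simp only [B]
    split_ifs with h1 h2 <;> [exact le_rfl; skip; skip] <;> rw [not_or] at h1 <;>
    · have e1 := mul_nonneg (h.nonneg j i) (hx2 j h1.2).le
      have e2 := mul_nonneg (h.nonneg m i) (by linarith : 0 ≤ 2 * x m - 1)
      have e3 := hx.1 i
      linarith
  have hBapply : ∀ (w : Fin n → ℝ) i, i ≠ m → (B *ᵥ w) i = 2 * x i * w i +
      ∑ j ∈ Finset.univ.erase m, C j i * (1 - 2 * x j) * w j +
      C m i * (2 * x m - 1) * ∑ j ∈ Finset.univ.erase m, w j := by
    intro w i hi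
    have e0 : B i m = 0 := by simp [B]
    have e1 : ∀ j ∈ Finset.univ.erase m, B i j * w j = (if i = j then 2 * x i * w j else 0) +
        C j i * (1 - 2 * x j) * w j + C m i * (2 * x m - 1) * w j := fun j hj => by
      simp only [B, hi, Finset.ne_of_mem_erase hj, or_self, if_false]
      split_ifs <;> ring
    simp only [Matrix.mulVec, dotProduct]
    rw [← Finset.add_sum_erase _ _ (Finset.mem_univ m), e0, zero_mul, zero_add,
      Finset.sum_congr rfl e1, Finset.sum_add_distrib, Finset.sum_add_distrib, Finset.mul_sum,
      Finset.sum_ite_eq, if_pos (by simp [hi])]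
  have hBm : ∀ w : Fin n → ℝ, (B *ᵥ w) m = 0 := fun w => by
    simp [B, Matrix.mulVec, dotProduct]
  have hsub : ∀ M : Fin n → ℝ, (∀ i, 0 ≤ M i) → (∀ i, M i ≤ (B *ᵥ M) i) → M = 0 := by
    intro M hM0 hM
    have hMm : M m = 0 := le_antisymm ((hM m).trans (hBm M).le) (hM0 m)
    set A := ∑ j ∈ Finset.univ.erase m, M j with hA
    have hA0 : 0 ≤ A := Finset.sum_nonneg fun j _ => hM0 j
    set κ := (2 * x m - 1) * A / c m with hκ
    have hκm : κ * c m = (2 * x m - 1) * A := div_mul_cancel₀ _ hcm.ne'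
    -- Flow rates minus the multiple of `c` with which they agree at `m`.
    let f : Fin n → ℝ := fun j =>
      (if j = m then (2 * x m - 1) * A else (1 - 2 * x j) * M j) - κ * c j
    have hf : ∀ i, f i ≤ 0 := by
      refine h.nonpos_of_subinvariant hm (by simp [f, hκm]) fun i hi => ?_
      have e1 : ∑ j, f j * C j i = (2 * x m - 1) * A * C m i +
          ∑ j ∈ Finset.univ.erase m, C j i * (1 - 2 * x j) * M j - κ * c i := by
        have e2 : ∑ j, f j * C j i = ∑ j, (if j = m then (2 * x m - 1) * A else
            (1 - 2 * x j) * M j) * C j i - κ * ∑ j, c j * C j i := by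
          rw [Finset.mul_sum _ _ κ, ← Finset.sum_sub_distrib]
          exact Finset.sum_congr rfl fun j _ => by simp only [f]; ring
        rw [e2, stationary_apply hc, ← Finset.add_sum_erase _ _ (Finset.mem_univ m), if_pos rfl]
        congr 2
        refine Finset.sum_congr rfl fun j hj => ?_
        rw [if_neg (Finset.ne_of_mem_erase hj)]; ring
      rw [e1]
      have e3 := hM i
      rw [hBapply M i hi] at e3
      simp only [f, if_neg hi]
      linarith
    have hMle : ∀ j, j ≠ m → M j ≤ κ / l * (flow (x j) / (1 - 2 * x j)) := fun j hj => by
      have := hf j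
      simp only [f, if_neg hj] at this
      rw [hxl, mul_div_assoc', le_div_iff₀ (hx2 j hj), div_mul_eq_mul_div, le_div_iff₀ hl]
      nlinarith
    have hAzero : A = 0 := by
      by_contra hAne
      have hApos := lt_of_le_of_ne hA0 (Ne.symm hAne)
      have hκpos : 0 < κ / l := by
        have : 0 < 2 * x m - 1 := by linarith
        positivity
      have h1 : A ≤ κ / l * ∑ j ∈ Finset.univ.erase m, flow (x j) / (1 - 2 * x j) := by
        rw [hA, Finset.mul_sum]
        exact Finset.sum_le_sum fun j hj => hMle j (Finset.ne_of_mem_erase hj)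
      have hterm : ∀ j, j ≠ m →
          flow (x j) / (1 - 2 * x j) ≤ x j * (x m / (2 * x m - 1)) ∧
          (0 < x j → flow (x j) / (1 - 2 * x j) < x j * (x m / (2 * x m - 1))) := fun j hj => by
        have hj2 := hx2 j hj
        have hm3 : 0 < 2 * x m - 1 := by linarith
        have hlt : (1 - x j) / (1 - 2 * x j) < x m / (2 * x m - 1) := by
          rw [div_lt_div_iff₀ hj2 hm3]
          nlinarith [hadd j hj]
        have e : flow (x j) / (1 - 2 * x j) = x j * ((1 - x j) / (1 - 2 * x j)) := by
          rw [flow, mul_div_assoc]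
        rw [e]
        exact ⟨mul_le_mul_of_nonneg_left hlt.le (hx.1 j), fun hp => mul_lt_mul_of_pos_left hlt hp⟩
      obtain ⟨i, hi, him, -⟩ := exists_third hr h.le_card m m
      have h2 : ∑ j ∈ Finset.univ.erase m, flow (x j) / (1 - 2 * x j) <
          flow (x m) / (2 * x m - 1) := by
        calc _ < ∑ j ∈ Finset.univ.erase m, x j * (x m / (2 * x m - 1)) :=
              Finset.sum_lt_sum (fun j hj => (hterm j (Finset.ne_of_mem_erase hj)).1)
                ⟨i, by simp [him], (hterm i him).2 (h.pos_of_flow_eq hc hx hl hxl hi)⟩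
          _ = _ := by
            rw [← Finset.sum_mul, ← one_sub_eq_sum_erase hx, flow]; ring
      have h3 : κ / l * (flow (x m) / (2 * x m - 1)) = A := by
        have : 2 * x m - 1 ≠ 0 := by linarith
        rw [hxl, hκ]
        field_simp
      linarith [mul_lt_mul_of_pos_left h2 hκpos]
    ext j
    by_cases hj : j = m
    · rw [hj, hMm]; rfl
    · exact (Finset.sum_eq_zero_iff_of_nonneg fun j _ => hM0 j).1 hAzero j (by simp [hj])
  obtain ⟨v, hv, ρ, hρ0, hρ1, hBv⟩ := exists_weight_of_forall_subinvariant m hB hsub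
  have hstep : ∀ (s : ℝ) (e : Fin n → ℝ), ∑ i, e i = 0 → (∀ i, i ≠ m → |e i| ≤ s * v i) →
      ∀ i, i ≠ m → |(jacobian C x *ᵥ e) i| ≤ ρ * s * v i := by
    intro s e he hes i hi
    have hem : ∑ j ∈ Finset.univ.erase m, e j = -e m := by
      rw [← Finset.add_sum_erase _ _ (Finset.mem_univ m)] at he
      linarith
    have e1 : (jacobian C x *ᵥ e) i = (B *ᵥ e) i := by
      rw [jacobian_mulVec_apply, hBapply e i hi, hem,
        ← Finset.add_sum_erase _ _ (Finset.mem_univ m)]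
      ring
    have hs : 0 ≤ s := nonneg_of_mul_nonneg_left ((abs_nonneg _).trans (hes i hi)) (hv i)
    rw [e1]
    calc |(B *ᵥ e) i| = |∑ j, B i j * e j| := rfl
      _ ≤ ∑ j, |B i j * e j| := Finset.abs_sum_le_sum_abs _ _
      _ ≤ ∑ j, s * (B i j * v j) := by
        refine Finset.sum_le_sum fun j _ => ?_
        by_cases hj : j = m
        · simp [B, hj]
        · rw [abs_mul, abs_of_nonneg (hB i j)]
          nlinarith [mul_le_mul_of_nonneg_left (hes j hj) (hB i j)]
      _ = s * (B *ᵥ v) i := by rw [← Finset.mul_sum]; rfl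
      _ ≤ s * (ρ * v i) := mul_le_mul_of_nonneg_left (hBv i) hs
      _ = _ := by ring
  have hsum : ∀ t : ℕ, ∑ i, (jacobian C x ^ t *ᵥ d) i = 0 := fun t => by
    induction t with
    | zero => simpa using hd
    | succ t ih => rw [pow_succ', ← Matrix.mulVec_mulVec, h.sum_jacobian_mulVec, ih]
  obtain ⟨s, hs⟩ : ∃ s, ∀ i, |d i| ≤ s * v i := by
    refine ⟨∑ j, |d j| / v j, fun i => ?_⟩
    rw [← div_le_iff₀ (hv i)]
    exact Finset.single_le_sum (f := fun j => |d j| / v j)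
      (fun j _ => div_nonneg (abs_nonneg _) (hv j).le) (Finset.mem_univ i)
  have hbd : ∀ t : ℕ, ∀ i, i ≠ m → |(jacobian C x ^ t *ᵥ d) i| ≤ ρ ^ t * s * v i := fun t => by
    induction t with
    | zero => intro i _; simpa using hs i
    | succ t ih =>
      rw [pow_succ', ← Matrix.mulVec_mulVec, pow_succ', mul_assoc ρ]
      exact hstep _ _ (hsum t) ih
  have hlim : ∀ i, i ≠ m → Tendsto (fun t => (jacobian C x ^ t *ᵥ d) i) atTop (𝓝 0) :=
    fun i hi => by
    refine squeeze_zero_norm (fun t => hbd t i hi) ?_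
    simpa using ((tendsto_pow_atTop_nhds_zero_of_lt_one hρ0 hρ1).mul_const s).mul_const (v i)
  rw [tendsto_pi_nhds]
  intro i
  by_cases hi : i = m
  · have e : ∀ t, (jacobian C x ^ t *ᵥ d) i =
        -∑ j ∈ Finset.univ.erase m, (jacobian C x ^ t *ᵥ d) j := fun t => by
      have := hsum t
      rw [← Finset.add_sum_erase _ _ (Finset.mem_univ m)] at this
      rw [hi]; linarith
    simp only [e]
    have := (tendsto_finsetSum (Finset.univ.erase m) fun j hj =>
      hlim j (Finset.ne_of_mem_erase hj)).neg
    simpa using this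
  · exact hlim i hi

/-- An equilibrium other than a vertex is linearly stable within the simplex. -/
theorem tendsto_jacobian_pow (hc : IsDominantLeftEigenvector C c) (hr : 3 ≤ r)
    (hx : x ∈ stdSimplex ℝ (Fin n)) (hl : 0 < l) (hxl : ∀ j, flow (x j) = l * c j)
    {d : Fin n → ℝ} (hd : ∑ i, d i = 0) :
    Tendsto (fun t => jacobian C x ^ t *ᵥ d) atTop (𝓝 0) := by
  have hrn := h.le_card
  have hpos : ∀ {i : Fin n}, i.val < r → 0 < x i := h.pos_of_flow_eq hc hx hl hxl
  by_cases hlt : ∀ i, x i < 1 / 2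
  · have h0 : (⟨0, by omega⟩ : Fin n).val < r := by simp; omega
    exact h.tendsto_jacobian_pow_of_le_half hx.1 h0 (hpos h0) (hlt _).le (fun i _ => hlt i) hd
  · push Not at hlt
    obtain ⟨m, hm⟩ := hlt
    have hmr : m.val < r := by
      by_contra hh
      rw [h.eq_zero_of_flow_eq hc (h.mem_nonAutocratic_of_flow_eq hc hx hl hxl) hxl
        (not_lt.1 hh)] at hm
      norm_num at hm
    rcases hm.eq_or_lt with heq | hlt
    · refine h.tendsto_jacobian_pow_of_le_half hx.1 hmr (hpos hmr) heq.ge (fun i hi => ?_) hd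
      linarith [h.add_lt_one_of_flow_eq hc hr hx hl hxl hi]
    · exact h.tendsto_jacobian_pow_of_half_lt hc hr hx hl hxl hmr hlt hd

end IsInfluenceNetwork

/-! ### Exponential convergence -/

/-- A nonnegative sequence that shrinks by a fixed factor every `N` steps is bounded by a geometric
one. -/
lemma exists_le_geometric {a : ℕ → ℝ} (ha : ∀ t, 0 ≤ a t) {N T : ℕ} (hN : 0 < N) {ρ : ℝ}
    (hρ0 : 0 < ρ) (hρ1 : ρ < 1) (hstep : ∀ t, T ≤ t → a (t + N) ≤ ρ * a t) :
    ∃ K σ : ℝ, 0 < σ ∧ σ < 1 ∧ ∀ t, a t ≤ K * σ ^ t := by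
  set σ : ℝ := ρ ^ ((N : ℝ)⁻¹) with hσ
  have hσ0 : 0 < σ := Real.rpow_pos_of_pos hρ0 _
  have hσ1 : σ < 1 := Real.rpow_lt_one hρ0.le hρ1 (by positivity)
  have hσN : σ ^ N = ρ := Real.rpow_inv_natCast_pow hρ0.le hN.ne'
  refine ⟨∑ t ∈ Finset.range (T + N), a t / σ ^ t, σ, hσ0, hσ1, fun t => ?_⟩
  induction t using Nat.strong_induction_on with
  | _ t ih =>
    by_cases ht : t < T + N
    · rw [← div_le_iff₀ (pow_pos hσ0 t)]
      exact Finset.single_le_sum (f := fun t => a t / σ ^ t)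
        (fun t _ => div_nonneg (ha t) (pow_pos hσ0 t).le) (Finset.mem_range.2 ht)
    · obtain ⟨s, rfl⟩ := Nat.exists_eq_add_of_le' (show N ≤ t by omega)
      refine (hstep s (by omega)).trans ?_
      rw [pow_add, hσN, mul_comm (σ ^ s), mul_left_comm]
      exact mul_le_mul_of_nonneg_left (ih s (by omega)) hρ0.le

lemma jacobian_clm_pow_apply (C : Matrix (Fin n) (Fin n) ℝ) (x d : Fin n → ℝ) (k : ℕ) :
    ((Matrix.mulVecLin (jacobian C x)).toContinuousLinearMap ^ k) d = jacobian C x ^ k *ᵥ d := by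
  induction k with
  | zero => simp
  | succ k ih =>
    rw [pow_succ', pow_succ', ← Matrix.mulVec_mulVec, ← ih]
    rfl

namespace IsInfluenceNetwork

variable (h : IsInfluenceNetwork r C)
include h

/-- A power of the Jacobian halves all vectors of sum zero, by looking at the spanning vectors
`eᵢ - eₘ`. -/
lemma exists_jacobian_pow_le (hc : IsDominantLeftEigenvector C c) (hr : 3 ≤ r)
    (hx : x ∈ stdSimplex ℝ (Fin n)) (hl : 0 < l) (hxl : ∀ j, flow (x j) = l * c j) :
    ∃ N : ℕ, 0 < N ∧ ∀ d : Fin n → ℝ, ∑ i, d i = 0 →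
      ‖jacobian C x ^ N *ᵥ d‖ ≤ 1 / 2 * ‖d‖ := by
  have hrn := h.le_card
  let m : Fin n := ⟨0, by omega⟩
  have hn : (0 : ℝ) < n := by
    have : 0 < n := by omega
    exact_mod_cast this
  have hlim : ∀ i : Fin n, Tendsto (fun t => ‖jacobian C x ^ t *ᵥ
      (Pi.single i 1 - Pi.single m 1 : Fin n → ℝ)‖) atTop (𝓝 0) := fun i => by
    have := h.tendsto_jacobian_pow hc hr hx hl hxl
      (d := (Pi.single i 1 - Pi.single m 1 : Fin n → ℝ)) (by simp)
    simpa using this.norm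
  have hev : ∀ᶠ t : ℕ in atTop, ∀ i : Fin n, ‖jacobian C x ^ t *ᵥ
      (Pi.single i 1 - Pi.single m 1 : Fin n → ℝ)‖ < 1 / 2 / n := by
    rw [eventually_all]
    exact fun i => (hlim i).eventually_lt_const (by positivity)
  obtain ⟨N, hN, hN0⟩ := (hev.and (eventually_gt_atTop 0)).exists
  refine ⟨N, hN0, fun d hd => ?_⟩
  have hdec : d = ∑ i, d i • (Pi.single i 1 - Pi.single m 1 : Fin n → ℝ) := by
    simp only [smul_sub, Finset.sum_sub_distrib, ← Finset.sum_smul, hd, zero_smul, sub_zero]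
    ext j
    simp [Finset.sum_apply, Pi.single_apply]
  calc ‖jacobian C x ^ N *ᵥ d‖
      = ‖∑ i, d i • (jacobian C x ^ N *ᵥ (Pi.single i 1 - Pi.single m 1 : Fin n → ℝ))‖ := by
        conv_lhs => rw [hdec]
        rw [Matrix.mulVec_sum]
        simp only [Matrix.mulVec_smul]
    _ ≤ ∑ i, ‖d i • (jacobian C x ^ N *ᵥ (Pi.single i 1 - Pi.single m 1 : Fin n → ℝ))‖ :=
        norm_sum_le _ _
    _ ≤ ∑ _i : Fin n, ‖d‖ * (1 / 2 / n) := by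
        refine Finset.sum_le_sum fun i _ => ?_
        rw [norm_smul]
        exact mul_le_mul (norm_le_pi_norm d i) (hN i).le (norm_nonneg _) (norm_nonneg _)
    _ = 1 / 2 * ‖d‖ := by
        rw [Finset.sum_const, Finset.card_univ, Fintype.card_fin, nsmul_eq_mul]
        field_simp

/-- Linear stability upgrades convergence to exponential convergence. -/
theorem convergesExponentially_of_tendsto (hc : IsDominantLeftEigenvector C c) (hr : 3 ≤ r)
    (hx : x ∈ stdSimplex ℝ (Fin n)) (hl : 0 < l) (hxl : ∀ j, flow (x j) = l * c j)
    (hx₀ : x₀ ∈ stdSimplex ℝ (Fin n))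
    (hlim : Tendsto (fun t => (dfMap C)^[t] x₀) atTop (𝓝 x)) :
    ConvergesExponentially (selfWeights C x₀) x := by
  obtain ⟨N, hN0, hN⟩ := h.exists_jacobian_pow_le hc hr hx hl hxl
  have hfix : dfMap C x = x := dfMap_eq_of_flow_eq hc hxl
  have hder := (hasFDerivAt_dfMap C x).iterate hfix N
  have hloc : ∀ᶠ y in 𝓝 x, y ∈ stdSimplex ℝ (Fin n) →
      ‖(dfMap C)^[N] y - x‖ ≤ 3 / 4 * ‖y - x‖ := by
    filter_upwards [hder.isLittleO.def (show (0 : ℝ) < 1 / 4 by norm_num)] with y hy hys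
    rw [Function.iterate_fixed hfix, jacobian_clm_pow_apply] at hy
    have h1 := hN (y - x) (by
      simp only [Pi.sub_apply, Finset.sum_sub_distrib, hys.2, hx.2, sub_self])
    calc ‖(dfMap C)^[N] y - x‖ = ‖((dfMap C)^[N] y - x - jacobian C x ^ N *ᵥ (y - x)) +
          jacobian C x ^ N *ᵥ (y - x)‖ := by rw [sub_add_cancel]
      _ ≤ _ := norm_add_le _ _
      _ ≤ 3 / 4 * ‖y - x‖ := by linarith
  obtain ⟨T, hT⟩ := eventually_atTop.1 (hlim.eventually hloc)
  obtain ⟨K, σ, hσ0, hσ1, hK⟩ := exists_le_geometric (a := fun t => ‖(dfMap C)^[t] x₀ - x‖)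
    (fun t => norm_nonneg _) hN0 (by norm_num : (0 : ℝ) < 3 / 4) (by norm_num) (T := T)
    fun t ht => by
      have := hT t ht (h.iterate_mem hx₀ t)
      rwa [← Function.iterate_add_apply, add_comm] at this
  exact ⟨K, σ, hσ0, hσ1, hK⟩

end IsInfluenceNetwork

/-! ### Two globally reachable nodes -/

/-- The self-weight held by the nodes that are not globally reachable, those from `r` on. -/
def transientMass {n : ℕ} (r : ℕ) (x : Fin n → ℝ) : ℝ :=
  ∑ i : Fin n, if i.val < r then 0 else x i

lemma transientMass_nonneg (hx : x ∈ stdSimplex ℝ (Fin n)) : 0 ≤ transientMass r x :=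
  Finset.sum_nonneg fun i _ => by split_ifs; exacts [le_rfl, hx.1 i]

lemma le_transientMass (hx : x ∈ stdSimplex ℝ (Fin n)) (i : Fin n) :
    (if i.val < r then 0 else x i) ≤ transientMass r x :=
  Finset.single_le_sum (f := fun i : Fin n => if i.val < r then 0 else x i)
    (fun i _ => by split_ifs; exacts [le_rfl, hx.1 i]) (Finset.mem_univ i)

lemma transientMass_lt_one (hx : x ∈ stdSimplex ℝ (Fin n)) {i : Fin n} (hi : i.val < r)
    (hxi : 0 < x i) : transientMass r x < 1 := by
  rw [← hx.2]
  refine Finset.sum_lt_sum (fun j _ => ?_) ⟨i, Finset.mem_univ i, ?_⟩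
  · split_ifs; exacts [hx.1 j, le_rfl]
  · rw [if_pos hi]; exact hxi

namespace IsInfluenceNetwork

variable (h : IsInfluenceNetwork r C)
include h

/-- The transient nodes lose the flow along the edges into the globally reachable ones. -/
lemma transientMass_dfMap (x : Fin n → ℝ) : transientMass r (dfMap C x) = transientMass r x -
    ∑ j : Fin n, if j.val < r then 0 else
      flow (x j) * ∑ i : Fin n, if i.val < r then C j i else 0 := by
  have e1 : ∀ j : Fin n, (∑ i : Fin n, if i.val < r then 0 else C j i) =
      (if j.val < r then 0 else 1) -
        (if j.val < r then 0 else ∑ i : Fin n, if i.val < r then C j i else 0) := by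
    intro j
    split_ifs with hj
    · rw [sub_zero]
      refine Finset.sum_eq_zero fun i _ => ?_
      split_ifs with hi
      · rfl
      · exact h.eq_zero_of_lt hj (not_lt.1 hi)
    · rw [eq_sub_iff_add_eq, ← Finset.sum_add_distrib, ← h.row_sum j]
      exact Finset.sum_congr rfl fun i _ => by split_ifs <;> simp
  have e2 : (∑ i : Fin n, if i.val < r then 0 else ∑ j, flow (x j) * C j i) =
      ∑ j, flow (x j) * ∑ i : Fin n, if i.val < r then 0 else C j i := by
    simp only [Finset.mul_sum]
    rw [Finset.sum_comm]
    refine Finset.sum_congr rfl fun i _ => ?_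
    split_ifs <;> simp
  have e3 : transientMass r (dfMap C x) = transientMass r x -
      (∑ i : Fin n, if i.val < r then 0 else flow (x i)) +
      ∑ i : Fin n, if i.val < r then 0 else ∑ j, flow (x j) * C j i := by
    unfold transientMass
    rw [← Finset.sum_sub_distrib, ← Finset.sum_add_distrib]
    refine Finset.sum_congr rfl fun i _ => ?_
    split_ifs
    · simp
    · exact dfMap_apply C x i
  rw [e3, e2, sub_add, ← Finset.sum_sub_distrib]
  congr 1
  refine Finset.sum_congr rfl fun j _ => ?_
  rw [e1]
  split_ifs <;> ring

lemma transientMass_dfMap_le (hx : x ∈ stdSimplex ℝ (Fin n)) {j i : Fin n} (hj : ¬ j.val < r)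
    (hi : i.val < r) : transientMass r (dfMap C x) ≤ transientMass r x - flow (x j) * C j i := by
  rw [h.transientMass_dfMap, sub_le_sub_iff_left]
  have h0 : ∀ j : Fin n, 0 ≤ ∑ i : Fin n, if i.val < r then C j i else 0 := fun j =>
    Finset.sum_nonneg fun i _ => by split_ifs; exacts [h.nonneg j i, le_rfl]
  have h1 : C j i ≤ ∑ i : Fin n, if i.val < r then C j i else 0 := by
    have := Finset.single_le_sum (f := fun i : Fin n => if i.val < r then C j i else 0)
      (fun i _ => by split_ifs; exacts [h.nonneg j i, le_rfl]) (Finset.mem_univ i)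
    simpa [hi] using this
  refine (mul_le_mul_of_nonneg_left h1 (flow_nonneg_of_mem_stdSimplex hx j)).trans ?_
  have := Finset.single_le_sum (f := fun j : Fin n => if j.val < r then 0 else
      flow (x j) * ∑ i : Fin n, if i.val < r then C j i else 0)
    (fun j _ => by
      split_ifs
      exacts [le_rfl, mul_nonneg (flow_nonneg_of_mem_stdSimplex hx j) (h0 j)])
    (Finset.mem_univ j)
  simpa [hj] using this

lemma transientMass_dfMap_le_self (hx : x ∈ stdSimplex ℝ (Fin n)) :
    transientMass r (dfMap C x) ≤ transientMass r x := by
  rw [h.transientMass_dfMap, sub_le_self_iff]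
  refine Finset.sum_nonneg fun j _ => ?_
  split_ifs
  · exact le_rfl
  · refine mul_nonneg (flow_nonneg_of_mem_stdSimplex hx j) (Finset.sum_nonneg fun i _ => ?_)
    split_ifs; exacts [h.nonneg j i, le_rfl]

lemma antitone_transientMass (hx : x ∈ stdSimplex ℝ (Fin n)) :
    Antitone fun k => transientMass r ((dfMap C)^[k] x) := by
  refine antitone_nat_of_succ_le fun k => ?_
  rw [Function.iterate_succ_apply']
  exact h.transientMass_dfMap_le_self (h.iterate_mem hx k)

/-- As long as the globally reachable nodes hold self-weight `p`, a fixed share of the self-weight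
of each transient node reaches them along a path. -/
lemma exists_transientMass_decrease {p : ℝ} (hp : 0 < p) (j : Fin n) :
    ∃ ε > 0, ∀ᶠ k in atTop, ∀ x ∈ stdSimplex ℝ (Fin n), transientMass r x ≤ 1 - p →
      transientMass r ((dfMap C)^[k] x) ≤
        transientMass r x - ε * (if j.val < r then 0 else x j) := by
  have htriv : ∀ j : Fin n, j.val < r → ∃ ε > 0, ∀ᶠ k in atTop, ∀ x ∈ stdSimplex ℝ (Fin n),
      transientMass r x ≤ 1 - p → transientMass r ((dfMap C)^[k] x) ≤
        transientMass r x - ε * (if j.val < r then 0 else x j) := fun j hj =>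
    ⟨1, one_pos, Eventually.of_forall fun k x hx _ => by
      simpa [hj] using h.antitone_transientMass hx (Nat.zero_le k)⟩
  have hrn := h.le_card
  have hr := h.two_le
  have h0 : (⟨0, by omega⟩ : Fin n).val < r := by simp; omega
  have hpath := h.reach j ⟨0, by omega⟩ h0
  induction hpath using Relation.ReflTransGen.head_induction_on with
  | refl => exact htriv _ h0
  | @head a b hab _ ih =>
    by_cases ha : a.val < r
    · exact htriv a ha
    have hflow : ∀ x ∈ stdSimplex ℝ (Fin n), transientMass r x ≤ 1 - p →
        p * x a ≤ flow (x a) := fun x hx hxp => by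
      have := le_transientMass (r := r) hx a
      rw [if_neg ha] at this
      unfold flow
      nlinarith [hx.1 a]
    by_cases hb : b.val < r
    · refine ⟨p * C a b, mul_pos hp hab, eventually_atTop.2 ⟨1, fun k hk x hx hxp => ?_⟩⟩
      rw [if_neg ha]
      have h1 : transientMass r ((dfMap C)^[k] x) ≤ transientMass r (dfMap C x) :=
        h.antitone_transientMass hx hk
      have h2 := h.transientMass_dfMap_le hx ha hb
      nlinarith [mul_le_mul_of_nonneg_right (hflow x hx hxp) hab.le]
    · obtain ⟨ε, hε, hev⟩ := ih
      obtain ⟨K, hK⟩ := eventually_atTop.1 hev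
      refine ⟨ε * (p * C a b), by positivity, eventually_atTop.2 ⟨K + 1, fun k hk x hx hxp => ?_⟩⟩
      obtain ⟨k, rfl⟩ := Nat.exists_eq_add_of_le' (Nat.one_le_of_lt hk)
      have h1 := h.transientMass_dfMap_le_self hx
      have h2 := hK k (by omega) _ (h.dfMap_mem hx) (h1.trans hxp)
      rw [if_neg hb] at h2
      rw [if_neg ha, Function.iterate_succ_apply]
      have h3 : p * C a b * x a ≤ dfMap C x b := by
        have e1 : flow (x a) * C a b ≤ ∑ i, flow (x i) * C i b :=
          Finset.single_le_sum (f := fun i => flow (x i) * C i b)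
            (fun i _ => mul_nonneg (flow_nonneg_of_mem_stdSimplex hx i) (h.nonneg i b))
            (Finset.mem_univ a)
        have e2 : 0 ≤ x b - flow (x b) := by unfold flow; nlinarith [sq_nonneg (x b)]
        rw [dfMap_apply]
        nlinarith [mul_le_mul_of_nonneg_right (hflow x hx hxp) hab.le]
      nlinarith [mul_le_mul_of_nonneg_left h3 hε.le]

lemma exists_transientMass_le_geometric (hx₀ : x₀ ∈ nonAutocratic n) :
    ∃ K σ : ℝ, 0 < σ ∧ σ < 1 ∧ ∀ t, transientMass r ((dfMap C)^[t] x₀) ≤ K * σ ^ t := by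
  have hrn := h.le_card
  have hr := h.two_le
  have hn : (0 : ℝ) < n := by
    have : 0 < n := by omega
    exact_mod_cast this
  have : Nonempty (Fin n) := ⟨⟨0, by omega⟩⟩
  have hmem := h.iterate_mem hx₀.1
  have hanti := h.antitone_transientMass hx₀.1
  obtain ⟨T, hT⟩ := (h.eventually_pos hx₀).exists
  have hT1 : transientMass r ((dfMap C)^[T] x₀) < 1 :=
    transientMass_lt_one (hmem T) (i := ⟨0, by omega⟩) (by simp; omega)
      (hT ⟨0, by omega⟩ (by simp; omega))
  set p := 1 - transientMass r ((dfMap C)^[T] x₀) with hp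
  choose ε hε hev using h.exists_transientMass_decrease (p := p) (by linarith)
  obtain ⟨N, hN, hN0⟩ := ((eventually_all.2 hev).and (eventually_gt_atTop 0)).exists
  obtain ⟨j₀, hj₀⟩ := Finite.exists_min ε
  refine exists_le_geometric (fun t => transientMass_nonneg (hmem t)) hN0 (T := T)
    (ρ := max (1 / 2) (1 - ε j₀ / n)) (by positivity)
    (max_lt (by norm_num) (by linarith [div_pos (hε j₀) hn])) fun t ht => ?_
  set y := (dfMap C)^[t] x₀ with hy
  have hyp : transientMass r y ≤ 1 - p := by
    rw [hp, sub_sub_cancel]; exact hanti ht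
  have h0 := transientMass_nonneg (r := r) (hmem t)
  have h1 : ∑ _j : Fin n, transientMass r ((dfMap C)^[N] y) ≤
      ∑ j : Fin n, (transientMass r y - ε j₀ * (if j.val < r then 0 else y j)) := by
    refine Finset.sum_le_sum fun j _ => (hN j y (hmem t) hyp).trans ?_
    refine sub_le_sub_left (mul_le_mul_of_nonneg_right (hj₀ j) ?_) _
    split_ifs; exacts [le_rfl, (hmem t).1 j]
  rw [Finset.sum_sub_distrib, ← Finset.mul_sum, Finset.sum_const, Finset.sum_const,
    Finset.card_univ, Fintype.card_fin, nsmul_eq_mul, nsmul_eq_mul] at h1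
  change _ ≤ _ - ε j₀ * transientMass r y at h1
  rw [add_comm, Function.iterate_add_apply]
  refine le_trans ?_ (mul_le_mul_of_nonneg_right (le_max_right _ _) h0)
  rw [sub_mul, one_mul, div_mul_eq_mul_div, le_sub_iff_add_le, ← le_sub_iff_add_le',
    div_le_iff₀ hn]
  linarith

end IsInfluenceNetwork

lemma sum_eq_add_add_transientMass (hn : 2 ≤ n) (f : Fin n → ℝ) :
    ∑ i, f i = f ⟨0, by omega⟩ + f ⟨1, by omega⟩ + transientMass 2 f := by
  have e : ∀ i : Fin n, f i = (if i = ⟨0, by omega⟩ then f i else 0) +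
      (if i = ⟨1, by omega⟩ then f i else 0) + (if i.val < 2 then 0 else f i) := by
    intro i
    rcases i with ⟨_ | _ | i, hi⟩ <;> simp
  unfold transientMass
  conv_lhs => rw [Finset.sum_congr rfl fun i _ => e i]
  rw [Finset.sum_add_distrib, Finset.sum_add_distrib]
  simp

namespace IsInfluenceNetwork

lemma firstTwo_mem (hn : 2 ≤ n) {α : ℝ} (hα : α ∈ Set.Icc (0 : ℝ) 1) :
    firstTwo n α ∈ stdSimplex ℝ (Fin n) := by
  refine ⟨fun i => ?_, ?_⟩
  · unfold firstTwo
    split_ifs <;> linarith [hα.1, hα.2]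
  · rw [sum_eq_add_add_transientMass hn]
    have : transientMass 2 (firstTwo n α) = 0 := Finset.sum_eq_zero fun i _ => by
      unfold firstTwo
      split_ifs <;> first | rfl | omega
    rw [this]
    simp [firstTwo]

lemma stationary_eq_half (h : IsInfluenceNetwork 2 C) (hc : IsDominantLeftEigenvector C c)
    {i : Fin n} (hi : i.val < 2) : c i = 1 / 2 := by
  refine h.stationary_center hc fun a b ha hb hab => ?_
  by_contra! hcon
  have : a = b := by
    rw [Ne, Fin.ext_iff, Ne, Fin.ext_iff] at hcon
    rw [Fin.ext_iff]
    omega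
  rw [this, h.diag] at hab
  exact hab.false

lemma equilibria_of_two (h : IsInfluenceNetwork 2 C) (hc : IsDominantLeftEigenvector C c) :
    equilibria C = vertices n ∪ firstTwo n '' Set.Icc (0 : ℝ) 1 := by
  have hn := h.le_card
  refine Set.Subset.antisymm (fun x hx => ?_)
    (Set.union_subset (vertices_subset_equilibria C) ?_)
  · by_cases hv : x ∈ vertices n
    · exact Or.inl hv
    right
    have hxn : x ∈ nonAutocratic n := by rw [nonAutocratic_eq]; exact ⟨hx.1, hv⟩
    obtain ⟨l, -, hxl⟩ := h.exists_flow_eq hc hxn hx.2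
    have h0 : ∀ i : Fin n, 2 ≤ i.val → x i = 0 := fun i hi => h.eq_zero_of_flow_eq hc hxn hxl hi
    have hsum := sum_eq_add_add_transientMass hn x
    have ht : transientMass 2 x = 0 := Finset.sum_eq_zero fun i _ => by
      split_ifs with hi; exacts [rfl, h0 i (not_lt.1 hi)]
    rw [hx.1.2, ht] at hsum
    refine ⟨x ⟨0, by omega⟩, ⟨hx.1.1 _, le_one_of_mem_stdSimplex hx.1 _⟩, ?_⟩
    ext i
    rcases i with ⟨_ | _ | i, hi⟩
    · simp [firstTwo]
    · simp only [firstTwo]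
      simp only [zero_add, one_ne_zero, if_false, if_true]
      linarith
    · simp [firstTwo, h0]
  · rintro _ ⟨α, hα, rfl⟩
    refine ⟨firstTwo_mem hn hα, dfMap_eq_of_flow_eq (l := 2 * (α * (1 - α))) hc fun i => ?_⟩
    by_cases hi : i.val < 2
    · rw [h.stationary_eq_half hc hi]
      have : i.val = 0 ∨ i.val = 1 := by omega
      rcases this with h1 | h1 <;> simp [firstTwo, h1, flow] <;> ring
    · rw [h.stationary_eq_zero hc (not_lt.1 hi)]
      have h1 : i.val ≠ 0 := by omega
      have h2 : i.val ≠ 1 := by omega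
      simp [firstTwo, h1, h2, flow]

/-- With two globally reachable nodes these swap their flows, so that each of their self-weights
changes by at most twice the transient self-weight. -/
lemma abs_dfMap_sub_le (h : IsInfluenceNetwork 2 C) (hn : 2 ≤ n) (hx : x ∈ stdSimplex ℝ (Fin n)) :
    |dfMap C x ⟨0, by omega⟩ - x ⟨0, by omega⟩| ≤ 2 * transientMass 2 x := by
  have hC : C ⟨1, by omega⟩ ⟨0, by omega⟩ = 1 := by
    have h1 := h.row_sum ⟨1, by omega⟩
    rw [sum_eq_add_add_transientMass hn, h.diag] at h1
    have h2 : transientMass 2 (C ⟨1, by omega⟩) = 0 := Finset.sum_eq_zero fun i _ => by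
      split_ifs with hi
      · rfl
      · exact h.eq_zero_of_lt (by simp) (not_lt.1 hi)
    rw [h2] at h1
    linarith
  have hsum := sum_eq_add_add_transientMass hn x
  rw [hx.2] at hsum
  have ht0 := transientMass_nonneg (r := 2) hx
  have hE := sum_eq_add_add_transientMass hn fun j => flow (x j) * C j ⟨0, by omega⟩
  set E := transientMass 2 fun j => flow (x j) * C j ⟨0, by omega⟩ with hEdef
  have hE0 : 0 ≤ E := Finset.sum_nonneg fun j _ => by
    split_ifs
    exacts [le_rfl, mul_nonneg (flow_nonneg_of_mem_stdSimplex hx j) (h.nonneg j _)]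
  have hE1 : E ≤ transientMass 2 x := Finset.sum_le_sum fun j _ => by
    split_ifs
    · exact le_rfl
    · have h1 : flow (x j) ≤ x j := by unfold flow; nlinarith [sq_nonneg (x j)]
      exact (mul_le_of_le_one_right (flow_nonneg_of_mem_stdSimplex hx j) (h.le_one j _)).trans h1
  have hx0 := hx.1 ⟨0, by omega⟩
  have hx1 := hx.1 ⟨1, by omega⟩
  rw [dfMap_apply, hE, h.diag, hC]
  set a := x ⟨0, by omega⟩
  set b := x ⟨1, by omega⟩
  set τ := transientMass 2 x
  have e : a - flow a + (flow a * 0 + flow b * 1 + E) - a = (b - a) * τ + E := by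
    have : τ = 1 - a - b := by linarith
    rw [this]; unfold flow; ring
  rw [e, abs_le]
  constructor <;> nlinarith

theorem convergesExponentially_of_two (h : IsInfluenceNetwork 2 C) (hx₀ : x₀ ∈ nonAutocratic n) :
    ∃ α ∈ Set.Icc (0 : ℝ) 1, ConvergesExponentially (selfWeights C x₀) (firstTwo n α) := by
  have hn := h.le_card
  have hmem := h.iterate_mem hx₀.1
  obtain ⟨K, σ, hσ0, hσ1, hK⟩ := h.exists_transientMass_le_geometric hx₀
  let i₀ : Fin n := ⟨0, by omega⟩
  have hdist : ∀ t, dist ((dfMap C)^[t] x₀ i₀) ((dfMap C)^[t + 1] x₀ i₀) ≤ 2 * K * σ ^ t := by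
    intro t
    rw [dist_comm, Real.dist_eq, Function.iterate_succ_apply', mul_assoc]
    exact (h.abs_dfMap_sub_le hn (hmem t)).trans (by linarith [hK t])
  obtain ⟨α, hα⟩ := cauchySeq_tendsto_of_complete (cauchySeq_of_le_geometric σ _ hσ1 hdist)
  have hαt := dist_le_of_le_geometric_of_tendsto σ _ hσ1 hdist hα
  refine ⟨α, ⟨ge_of_tendsto' hα fun t => (hmem t).1 i₀,
    le_of_tendsto' hα fun t => le_one_of_mem_stdSimplex (hmem t) i₀⟩,
    2 * K / (1 - σ) + K, σ, hσ0, hσ1, fun t => ?_⟩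
  have hτ0 := transientMass_nonneg (r := 2) (hmem t)
  have hd := hαt t
  rw [Real.dist_eq] at hd
  have hτ := hK t
  have hbound : (2 * K / (1 - σ) + K) * σ ^ t = 2 * K * σ ^ t / (1 - σ) + K * σ ^ t := by ring
  have hd0 := abs_nonneg ((dfMap C)^[t] x₀ i₀ - α)
  rw [hbound, pi_norm_le_iff_of_nonneg (by linarith)]
  intro i
  rw [Pi.sub_apply, Real.norm_eq_abs, selfWeights]
  rcases i with ⟨_ | _ | i, hi⟩
  · simp only [firstTwo, if_true]
    exact hd.trans (by linarith)
  · have hsum := sum_eq_add_add_transientMass hn ((dfMap C)^[t] x₀)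
    rw [(hmem t).2] at hsum
    have e : (dfMap C)^[t] x₀ ⟨0 + 1, hi⟩ - firstTwo n α ⟨0 + 1, hi⟩ =
        -((dfMap C)^[t] x₀ i₀ - α) - transientMass 2 ((dfMap C)^[t] x₀) := by
      simp only [firstTwo, zero_add, one_ne_zero, if_false, if_true]
      linarith
    rw [e]
    refine (abs_sub _ _).trans ?_
    rw [abs_neg, abs_of_nonneg hτ0]
    linarith
  · have h1 := le_transientMass (r := 2) (hmem t) ⟨i + 1 + 1, hi⟩
    have e : firstTwo n α ⟨i + 1 + 1, hi⟩ = 0 := by simp [firstTwo]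
    rw [if_neg (by simp)] at h1
    rw [e, sub_zero, abs_of_nonneg ((hmem t).1 _)]
    linarith

end IsInfluenceNetwork

end SocialPower

theorem theorem3 {n r : ℕ} (hr : 2 ≤ r) (hrn : r ≤ n)
    (C : Matrix (Fin n) (Fin n) ℝ)
    (hC : C ∈ Matrix.rowStochastic ℝ (Fin n))
    (hdiag : ∀ i, C i i = 0)
    (hred : ¬ C.IsIrreducible)
    (hreach : ∀ i : Fin n,
      SocialPower.IsGloballyReachable (SocialPower.assocDigraph C) i ↔ i.val < r) :
    (r = 2 →
      SocialPower.equilibria C =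
        SocialPower.vertices n ∪ SocialPower.firstTwo n '' Set.Icc (0 : ℝ) 1 ∧
      ∀ x₀ ∈ stdSimplex ℝ (Fin n) \ SocialPower.vertices n,
        ∃ α ∈ Set.Icc (0 : ℝ) 1,
          SocialPower.ConvergesExponentially (SocialPower.selfWeights C x₀)
            (SocialPower.firstTwo n α)) ∧
    (3 ≤ r → ∀ k : Fin r,
      SocialPower.HasStarTopology
        (SocialPower.assocDigraph (SocialPower.firstBlock hrn C)) k →
      SocialPower.equilibria C = SocialPower.vertices n ∧
      ∀ x₀ ∈ stdSimplex ℝ (Fin n) \ SocialPower.vertices n,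
        Filter.Tendsto (SocialPower.selfWeights C x₀) Filter.atTop
          (nhds (Pi.single (Fin.castLE hrn k) 1))) ∧
    (3 ≤ r →
      (¬ ∃ k : Fin r, SocialPower.HasStarTopology
        (SocialPower.assocDigraph (SocialPower.firstBlock hrn C)) k) →
      ∃ xs ∈ stdSimplex ℝ (Fin n) \ SocialPower.vertices n,
        SocialPower.equilibria C = SocialPower.vertices n ∪ {xs} ∧
        (∀ i : Fin n, i.val < r → 0 < xs i) ∧
        (∀ i : Fin n, r ≤ i.val → xs i = 0) ∧
        (∃ c : Fin n → ℝ, SocialPower.IsDominantLeftEigenvector C c ∧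
          (∀ c', SocialPower.IsDominantLeftEigenvector C c' → c' = c) ∧
          ∀ i j : Fin n, xs i ≤ xs j ↔ c i ≤ c j) ∧
        ∀ x₀ ∈ stdSimplex ℝ (Fin n) \ SocialPower.vertices n,
          SocialPower.ConvergesExponentially (SocialPower.selfWeights C x₀) xs) := by
  have h := SocialPower.IsInfluenceNetwork.of_globallyReachable hr hrn hC hdiag hreach
  obtain ⟨c, hc⟩ := h.exists_dominantLeftEigenvector
  rw [← SocialPower.nonAutocratic_eq]
  refine ⟨fun hr2 => ?_, fun hr3 k hstar => ?_, fun hr3 hstar => ?_⟩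
  · subst hr2
    exact ⟨h.equilibria_of_two hc, fun x₀ hx₀ => h.convergesExponentially_of_two hx₀⟩
  · have hck : c (Fin.castLE hrn k) = 1 / 2 := by
      refine h.stationary_center hc fun i j hi hj hij => ?_
      rcases hstar ⟨i, hi⟩ ⟨j, hj⟩ hij with hh | hh
      · left; rw [← hh]; rfl
      · right; rw [← hh]; rfl
    refine ⟨Set.Subset.antisymm (fun x hx => ?_) (SocialPower.vertices_subset_equilibria C),
      fun x₀ hx₀ => h.tendsto_center hc hr3 hck hx₀⟩
    by_contra hv
    have hxn : x ∈ SocialPower.nonAutocratic n := by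
      rw [SocialPower.nonAutocratic_eq]; exact ⟨hx.1, hv⟩
    obtain ⟨l, hl, hxl⟩ := h.exists_flow_eq hc hxn hx.2
    exact h.not_flow_eq_of_center hc hr3 hck hx.1 hl hxl
  · have hc2 : ∀ k, c k < 1 / 2 := by
      refine h.stationary_lt_half hc ?_
      rintro ⟨k, hk, hk'⟩
      refine hstar ⟨⟨k, hk⟩, fun i j hij => ?_⟩
      rcases hk' (Fin.castLE hrn i) (Fin.castLE hrn j) i.2 j.2 hij with hh | hh
      · left; subst hh; rfl
      · right; subst hh; rfl
    obtain ⟨xs, hxs, l, hl, hxl, hlim⟩ := h.exists_tendsto hc hr3 hc2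
    have hxsn := h.mem_nonAutocratic_of_flow_eq hc hxs hl hxl
    refine ⟨xs, hxsn, Set.Subset.antisymm (fun x hx => ?_)
      (Set.union_subset (SocialPower.vertices_subset_equilibria C) ?_),
      fun i hi => h.pos_of_flow_eq hc hxs hl hxl hi,
      fun i hi => h.eq_zero_of_flow_eq hc hxsn hxl hi,
      ⟨c, hc, fun c' hc' => h.dominantLeftEigenvector_unique hc hc',
        h.le_iff_of_flow_eq hc hr3 hxs hl hxl⟩,
      fun x₀ hx₀ =>
        h.convergesExponentially_of_tendsto hc hr3 hxs hl hxl hx₀.1 (hlim x₀ hx₀)⟩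
    · by_cases hv : x ∈ SocialPower.vertices n
      · exact Or.inl hv
      · right
        have hxn : x ∈ SocialPower.nonAutocratic n := by
          rw [SocialPower.nonAutocratic_eq]; exact ⟨hx.1, hv⟩
        obtain ⟨l', hl', hxl'⟩ := h.exists_flow_eq hc hxn hx.2
        exact h.eq_of_flow_eq hc hr3 hxs hl hxl hx.1 hl' hxl'
    · rintro _ rfl
      exact ⟨hxs, SocialPower.IsInfluenceNetwork.dfMap_eq_of_flow_eq hc hxl⟩
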